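/- Let $n_A,n_B\ge 0$ be integers. **Cut polytopes and facets.** For a finite graph $G=(V,E)$ and a labelling $S:V\to\{0,1\}$, the cut vector $\delta(S)\in\mathbb R^E$ has $\delta_{uv}(S)=1$ if $S(u)\ne S(v)$ and $\delta_{uv}(S)=0$ otherwise; the cut polytope $\mathrm{CUT}(G)$ is the convex hull of all cut vectors. A linear inequality is facet inducing for a polytope $P$ if it is valid on $P$ and the face of $P$ on which it holds with equality is nonempty and has dimension $\dim P-1$. **Triangular elimination.** Let $K_{1+n_A+n_B}$ be the complete graph on the nodes $X,A_1,\dots,A_{n_A},B_1,\dots,B_{n_B}$. Put $m_A=n_A+\binom{n_B}{2}$ and $m_B=n_B+\binom{n_A}{2}$, and let $K_{1,m_A,m_B}$ be the complete tripartite graph with classes $\{X\}$, $\{A_i\}\cup\{A'_{B_jB_{j'}}: j<j'\}$ and $\{B_j\}\cup\{B'_{A_iA_{i'}}: i<i'\}$, where the $A'_{B_jB_{j'}}$ and $B'_{A_iA_{i'}}$ are new nodes. The triangular elimination of an inequality $a^Tx\le 0$ on $\mathbb R^{E(K_{1+n_A+n_B})}$ is the inequality $$\sum_i a_{XA_i}x_{XA_i}+\sum_j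 a_{XB_j}x_{XB_j}+\sum_{i,j}a_{A_iB_j}x_{A_iB_j} +\sum_{i<i'}\bigl(a_{A_iA_{i'}}x_{A_iB'_{A_iA_{i'}}}-|a_{A_iA_{i'}}|\,x_{A_{i'}B'_{A_iA_{i'}}}\bigr) +\sum_{j<j'}\bigl(a_{B_jB_{j'}}x_{A'_{B_jB_{j'}}B_j}-|a_{B_jB_{j'}}|\,x_{A'_{B_jB_{j'}}B_{j'}}\bigr)\le 0$$ on $\mathbb R^{E(K_{1,m_A,m_B})}$. **Bell inequalities.** For $s\in\{0,1\}^{m_A}$ and $t\in\{0,1\}^{m_B}$ let $q(s,t)$ be the vector with coordinates $q_{A_i}=s_i$, $q_{B_j}=t_j$, $q_{A_iB_j}=s_it_j$, where $A_i$, $B_j$ now run over all $m_A$ and $m_B$ nodes of the two classes. The correlation polytope is the convex hull of all $q(s,t)$. A tight Bell inequality is a facet inducing inequality of the correlation polytope. **Theorem.** Let $a^Tx\le 0$ be facet inducing for $\mathrm{CUT}(K_{1+n_A+n_B})$. 1. Its triangular elimination is facet inducing for $\mathrm{CUT}(K_{1,m_A,m_B})$ if and only if $a^Tx\le 0$ is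 not a positive multiple of a triangle inequality $x_{uv}-x_{uw}-x_{vw}\le 0$ on three distinct nodes $u,v,w$ that all lie in $\{X,A_1,\dots,A_{n_A}\}$ or all lie in $\{X,B_1,\dots,B_{n_B}\}$. (Up to relabelling the nodes within a party, exchanging the parties, and switching, the exceptions are $-x_{XA_1}-x_{XA_2}+x_{A_1A_2}\le0$ and $-x_{A_1A_2}-x_{A_1A_3}+x_{A_2A_3}\le0$.) 2. The linear isomorphism $x_{XA_i}=q_{A_i}$, $x_{XB_j}=q_{B_j}$, $x_{A_iB_j}=q_{A_i}+q_{B_j}-2q_{A_iB_j}$ maps the correlation polytope onto $\mathrm{CUT}(K_{1,m_A,m_B})$, and under it the facet inducing inequalities of $\mathrm{CUT}(K_{1,m_A,m_B})$ correspond exactly to the tight Bell inequalities. In particular, the Bell inequality obtained from the triangular elimination of $a^Tx\le0$ is tight, with exactly the same exceptions. -/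

import Mathlib

noncomputable section

namespace TriangularElimination

/-! ### Polytopes and facets -/

/-- The dimension of a set in a real vector space: the dimension of its affine hull
(for nonempty sets). -/
def affDim {E : Type*} [AddCommGroup E] [Module ℝ E] (P : Set E) : ℕ :=
  Module.finrank ℝ (vectorSpan ℝ P)

/-- The inequality `f x ≤ c` is facet inducing for the polytope `P`: it is valid on `P`, and the
face where it holds with equality is nonempty and has dimension `dim P - 1`. -/
def IsFacetInducing {E : Type*} [AddCommGroup E] [Module ℝ E] (P : Set E)
    (f : Module.Dual ℝ E) (c : ℝ) : Prop :=
  (∀ x ∈ P, f x ≤ c) ∧ {x ∈ P | f x = c}.Nonempty ∧ affDim {x ∈ P | f x = c} + 1 = affDim P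

/-! ### Cut polytopes of graphs -/

/-- The cut vector of the `0/1` labelling `S` of the nodes: `1` on edges whose ends have different
labels, `0` on edges whose ends have the same label. -/
def cutVector {V : Type*} (G : SimpleGraph V) (S : V → Bool) : G.edgeSet → ℝ := fun e =>
  Sym2.lift ⟨fun u v => if S u = S v then (0 : ℝ) else 1,
    fun u v => by simp only [eq_comm]⟩ e.1

/-- The cut polytope of `G`, in the space with one coordinate for each edge of `G`. -/
def cutPolytope {V : Type*} (G : SimpleGraph V) : Set (G.edgeSet → ℝ) :=
  convexHull ℝ (Set.range (cutVector G))

/-- The edge `uv` of `G`. -/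
def edge {V : Type*} (G : SimpleGraph V) (u v : V) (h : G.Adj u v) : G.edgeSet :=
  ⟨s(u, v), h⟩

/-- The coordinate functional `x ↦ x_{uv}`. -/
def coord {V : Type*} (G : SimpleGraph V) (u v : V) (h : G.Adj u v) :
    Module.Dual ℝ (G.edgeSet → ℝ) :=
  LinearMap.proj (edge G u v h)

/-- The linear form `x ↦ aᵀx = ∑ₑ aₑ xₑ` with coefficient vector `a`. -/
def linForm {ι : Type*} [Fintype ι] (a : ι → ℝ) : Module.Dual ℝ (ι → ℝ) :=
  ∑ e, a e • LinearMap.proj e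

/-! ### The nodes `X`, `A_i`, `B_j`, and the graphs `K_{1+n_A+n_B}`, `K_{1,m_A,m_B}` -/

/-- The nodes: one node `X`, Alice's nodes `A_i` and Bob's nodes `B_j`. -/
inductive Node (α β : Type*) where
  | X : Node α β
  | A : α → Node α β
  | B : β → Node α β
  deriving DecidableEq, Fintype

/-- The class of a node: `0` for `X`, `1` for Alice's nodes, `2` for Bob's nodes. -/
def Node.party {α β : Type*} : Node α β → Fin 3
  | .X => 0
  | .A _ => 1
  | .B _ => 2

/-- The complete graph on the nodes `X`, `A_i`, `B_j`. -/
abbrev completeNodeGraph (α β : Type*) : SimpleGraph (Node α β) := ⊤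

theorem complete_adj {α β : Type*} {u v : Node α β} (h : u ≠ v) :
    (completeNodeGraph α β).Adj u v := h

/-- The complete tripartite graph with classes `{X}`, `{A_i}`, `{B_j}`. -/
def tripartite (α β : Type*) : SimpleGraph (Node α β) :=
  (⊤ : SimpleGraph (Fin 3)).comap Node.party

theorem tripartite_adj {α β : Type*} (u v : Node α β) :
    (tripartite α β).Adj u v ↔ u.party ≠ v.party := Iff.rfl

theorem adj_XA {α β : Type*} (i : α) : (tripartite α β).Adj .X (.A i) := by
  simp [tripartite_adj, Node.party]

theorem adj_XB {α β : Type*} (j : β) : (tripartite α β).Adj .X (.B j) := by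
  simp [tripartite_adj, Node.party]

theorem adj_AB {α β : Type*} (i : α) (j : β) : (tripartite α β).Adj (.A i) (.B j) := by
  simp [tripartite_adj, Node.party]

/-! ### Triangular elimination -/

/-- Pairs `k < l` of indices below `n`. -/
abbrev Pairs (n : ℕ) : Type := {p : Fin n × Fin n // p.1 < p.2}

/-- Alice's observables after the elimination: `A_i` for `i < n_A` and one new `A'_{B_j B_j'}` for
each pair `j < j'` of Bob's indices. -/
abbrev NewA (nA nB : ℕ) : Type := Fin nA ⊕ Pairs nB

/-- Bob's observables after the elimination: `B_j` for `j < n_B` and one new `B'_{A_i A_i'}` for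
each pair `i < i'` of Alice's indices. -/
abbrev NewB (nA nB : ℕ) : Type := Fin nB ⊕ Pairs nA

/-- The left-hand side `a'ᵀx'` of the triangular elimination of the inequality `aᵀx ≤ a₀`. -/
def elimination {nA nB : ℕ} (a : (completeNodeGraph (Fin nA) (Fin nB)).edgeSet → ℝ) :
    Module.Dual ℝ ((tripartite (NewA nA nB) (NewB nA nB)).edgeSet → ℝ) :=
  let K := completeNodeGraph (Fin nA) (Fin nB)
  let T := tripartite (NewA nA nB) (NewB nA nB)
  (∑ i : Fin nA, a (edge K .X (.A i) (complete_adj (by simp))) • coord T .X (.A (.inl i)) (adj_XA _))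
  + (∑ j : Fin nB, a (edge K .X (.B j) (complete_adj (by simp))) • coord T .X (.B (.inl j)) (adj_XB _))
  + (∑ i : Fin nA, ∑ j : Fin nB,
      a (edge K (.A i) (.B j) (complete_adj (by simp))) • coord T (.A (.inl i)) (.B (.inl j)) (adj_AB _ _))
  + (∑ p : Pairs nA,
      (a (edge K (.A p.1.1) (.A p.1.2) (complete_adj (by simpa using p.2.ne)))
          • coord T (.A (.inl p.1.1)) (.B (.inr p)) (adj_AB _ _)
        - |a (edge K (.A p.1.1) (.A p.1.2) (complete_adj (by simpa using p.2.ne)))|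
          • coord T (.A (.inl p.1.2)) (.B (.inr p)) (adj_AB _ _)))
  + (∑ p : Pairs nB,
      (a (edge K (.B p.1.1) (.B p.1.2) (complete_adj (by simpa using p.2.ne)))
          • coord T (.A (.inr p)) (.B (.inl p.1.1)) (adj_AB _ _)
        - |a (edge K (.B p.1.1) (.B p.1.2) (complete_adj (by simpa using p.2.ne)))|
          • coord T (.A (.inr p)) (.B (.inl p.1.2)) (adj_AB _ _)))

/-- `aᵀx ≤ 0` is, up to a positive factor, a triangle inequality `x_{uv} - x_{uw} - x_{vw} ≤ 0` on
three distinct nodes that all lie in `{X} ∪ {A_i}` or all lie in `{X} ∪ {B_j}`. -/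
def IsOneSidedTriangle {nA nB : ℕ}
    (a : (completeNodeGraph (Fin nA) (Fin nB)).edgeSet → ℝ) : Prop :=
  ∃ (u v w : Node (Fin nA) (Fin nB)) (huv : u ≠ v) (huw : u ≠ w) (hvw : v ≠ w) (c : ℝ),
    0 < c ∧
    ((u.party ≠ 2 ∧ v.party ≠ 2 ∧ w.party ≠ 2) ∨ (u.party ≠ 1 ∧ v.party ≠ 1 ∧ w.party ≠ 1)) ∧
    linForm a = c • (coord (completeNodeGraph _ _) u v huv
      - coord (completeNodeGraph _ _) u w huw - coord (completeNodeGraph _ _) v w hvw)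

/-! ### Correlation polytopes and Bell inequalities -/

/-- The coordinates `q_{A_i}`, `q_{B_j}`, `q_{A_i B_j}` of an experimental result. -/
inductive ResultIndex (α β : Type*) where
  | A : α → ResultIndex α β
  | B : β → ResultIndex α β
  | AB : α → β → ResultIndex α β

/-- The experimental result of the classical configuration in which the observables `A_i`, `B_j`
have the outcomes `s i`, `t j`. -/
def configVector {α β : Type*} (s : α → Bool) (t : β → Bool) : ResultIndex α β → ℝ
  | .A i => if s i = true then 1 else 0
  | .B j => if t j = true then 1 else 0
  | .AB i j => if s i = true ∧ t j = true then 1 else 0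

/-- The correlation polytope: all experimental results with a local hidden variable model, i.e. the
convex combinations of the classical configurations. -/
def correlationPolytope (α β : Type*) : Set (ResultIndex α β → ℝ) :=
  convexHull ℝ {q | ∃ s t, q = configVector s t}

/-- `g q ≤ c` is a tight Bell inequality: a Bell inequality (valid for all experimental results with
a local hidden variable model) that induces a facet. -/
def IsTightBell {α β : Type*} (g : Module.Dual ℝ (ResultIndex α β → ℝ)) (c : ℝ) : Prop :=
  IsFacetInducing (correlationPolytope α β) g c

/-- The edge of `K_{1,m_A,m_B}` that corresponds to a coordinate of an experimental result. -/
def resultEdge {α β : Type*} : ResultIndex α β → (tripartite α β).edgeSet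
  | .A i => edge _ .X (.A i) (adj_XA i)
  | .B j => edge _ .X (.B j) (adj_XB j)
  | .AB i j => edge _ (.A i) (.B j) (adj_AB i j)

theorem resultEdge_bijective {α β : Type*} :
    Function.Bijective (resultEdge : ResultIndex α β → _) := by
  constructor
  · rintro (i | j | ⟨i, j⟩) (i' | j' | ⟨i', j'⟩) h <;>
      simp_all [resultEdge, edge, Subtype.ext_iff]
  · rintro ⟨e, he⟩
    induction e using Sym2.ind with
    | _ u v =>
      have h : u.party ≠ v.party := he
      rcases u with _ | i | j <;> rcases v with _ | i' | j' <;>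
        first
        | exact absurd rfl h
        | exact ⟨.A _, rfl⟩
        | exact ⟨.B _, rfl⟩
        | exact ⟨.AB _ _, rfl⟩
        | exact ⟨.A _, Subtype.ext Sym2.eq_swap⟩
        | exact ⟨.B _, Subtype.ext Sym2.eq_swap⟩
        | exact ⟨.AB _ _, Subtype.ext Sym2.eq_swap⟩

/-- The edges of `K_{1,m_A,m_B}` correspond to the coordinates of an experimental result. -/
def resultEdgeEquiv (α β : Type*) : ResultIndex α β ≃ (tripartite α β).edgeSet :=
  Equiv.ofBijective resultEdge resultEdge_bijective

/-- The cut coordinates of an experimental result, indexed by `ResultIndex`: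
`x_{XA_i} = q_{A_i}`, `x_{XB_j} = q_{B_j}`, `x_{A_iB_j} = q_{A_i} + q_{B_j} - 2 q_{A_iB_j}`. -/
def toCutCoord {α β : Type*} (q : ResultIndex α β → ℝ) : ResultIndex α β → ℝ
  | .A i => q (.A i)
  | .B j => q (.B j)
  | .AB i j => q (.A i) + q (.B j) - 2 * q (.AB i j)

/-- The isomorphism from the space of experimental results onto the space of the cut polytope of
`K_{1,m_A,m_B}`: `x_{XA_i} = q_{A_i}`, `x_{XB_j} = q_{B_j}`,
`x_{A_iB_j} = q_{A_i} + q_{B_j} - 2 q_{A_iB_j}`, with inverse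
`q_{A_iB_j} = (x_{XA_i} + x_{XB_j} - x_{A_iB_j}) / 2`. -/
def bellIso (α β : Type*) :
    (ResultIndex α β → ℝ) ≃ₗ[ℝ] ((tripartite α β).edgeSet → ℝ) where
  toFun q := fun e => toCutCoord q ((resultEdgeEquiv α β).symm e)
  invFun x := fun
    | .A i => x (edge _ .X (.A i) (adj_XA i))
    | .B j => x (edge _ .X (.B j) (adj_XB j))
    | .AB i j => (x (edge _ .X (.A i) (adj_XA i)) + x (edge _ .X (.B j) (adj_XB j))
        - x (edge _ (.A i) (.B j) (adj_AB i j))) / 2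
  map_add' q q' := by
    funext e
    obtain ⟨r, rfl⟩ := (resultEdgeEquiv α β).surjective e
    rcases r with i | j | ⟨i, j⟩ <;> simp [toCutCoord]
    ring
  map_smul' c q := by
    funext e
    obtain ⟨r, rfl⟩ := (resultEdgeEquiv α β).surjective e
    rcases r with i | j | ⟨i, j⟩ <;> simp [toCutCoord]
    ring
  left_inv q := by
    have hA : ∀ i, (resultEdgeEquiv α β).symm (edge _ .X (.A i) (adj_XA i)) = .A i :=
      fun i => (resultEdgeEquiv α β).symm_apply_apply (.A i)
    have hB : ∀ j, (resultEdgeEquiv α β).symm (edge _ .X (.B j) (adj_XB j)) = .B j :=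
      fun j => (resultEdgeEquiv α β).symm_apply_apply (.B j)
    have hAB : ∀ i j, (resultEdgeEquiv α β).symm (edge _ (.A i) (.B j) (adj_AB i j)) = .AB i j :=
      fun i j => (resultEdgeEquiv α β).symm_apply_apply (.AB i j)
    funext r
    rcases r with i | j | ⟨i, j⟩ <;> simp [hA, hB, hAB, toCutCoord]
  right_inv x := by
    funext e
    obtain ⟨r, rfl⟩ := (resultEdgeEquiv α β).surjective e
    simp only [Equiv.symm_apply_apply]
    rcases r with i | j | ⟨i, j⟩ <;> simp [toCutCoord, resultEdgeEquiv, resultEdge]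
    ring

end TriangularElimination

end

open TriangularElimination

noncomputable section

namespace TriangularElimination

section

/-! ### Facets of convex hulls -/

/-! The cut vectors of a graph span the whole space and include `0`. Hence a valid homogeneous
inequality is facet inducing iff its form is nonzero and every form vanishing on its roots (the cuts
where it is tight) is a multiple of it (`isFacetInducing_cutPolytope_iff`).

The eliminated form at a cut equals the original form at the restriction to the old nodes, minus one
nonnegative slack for each pair of nodes of the same party (`elimination_cutVector`). This gives
validity and describes the new roots: the restriction is a root and all slacks vanish. Giving each
new node the label of the second node of its pair always makes the slacks vanish, so every old root
extends. If the pair has positive coefficient and is not separated, or negative coefficient and is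
separated, the new node may moreover move freely.

Let `g` vanish on the new roots. Moving a free new node gives a linear relation among the signs of
its neighbours. Moving two free new nodes kills the coefficients between new nodes
(`coeff_new_new_eq_zero`). For the old neighbours, multiplying the relation by the sign sum or
difference of the pair yields a form on the complete graph that vanishes on all old roots, hence a
multiple of `a`. Comparing signs under single flips then shows that the relation involves only the
pair itself, unless `a` is a triangle inequality on the pair and a neighbour of the new node
(`sign_relation_same`, `sign_relation_opposite`). Such neighbours lie in `X` or in the party of the
pair, whence the one-sided exceptions. Finally, contracting each new node to the second node of its
pair turns `g` into a form vanishing on the old roots; subtracting a multiple of the elimination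
leaves a form whose contraction is zero, and such a form is zero (`eq_zero_of_back`).

For a one-sided triangle, the new roots satisfy a second triangle equation through a new node that
is not a multiple of the elimination. The Bell statement is a linear change of coordinates: an
outcome records whether a node is separated from `X`. -/

theorem vectorSpan_eq_span_of_zero_mem {E : Type*} [AddCommGroup E] [Module ℝ E] {s : Set E}
    (h : (0 : E) ∈ s) : vectorSpan ℝ s = Submodule.span ℝ s := by
  rw [vectorSpan_eq_span_vsub_set_right ℝ h]
  simp

/-- A convex combination of points with `f ≤ 0` can have `f = 0` only if every point of positive
weight has `f = 0`. The set `C` in the proof is a convex form of this statement. -/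
theorem span_face_eq {E ι : Type*} [AddCommGroup E] [Module ℝ E] {v : ι → E}
    {f : Module.Dual ℝ E} (hf : ∀ i, f (v i) ≤ 0) :
    Submodule.span ℝ {x ∈ convexHull ℝ (Set.range v) | f x = 0} =
      Submodule.span ℝ (v '' {i | f (v i) = 0}) := by
  apply le_antisymm
  · rw [Submodule.span_le]
    rintro x ⟨hx, hfx⟩
    let C : Set E := {x | f x ≤ 0 ∧ (f x = 0 → x ∈ Submodule.span ℝ (v '' {i | f (v i) = 0}))}
    have hC : Convex ℝ C := by
      rintro x ⟨hx, hx'⟩ y ⟨hy, hy'⟩ a b ha hb -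
      have h1 : a * f x ≤ 0 := mul_nonpos_of_nonneg_of_nonpos ha hx
      have h2 : b * f y ≤ 0 := mul_nonpos_of_nonneg_of_nonpos hb hy
      refine ⟨by simpa using add_nonpos h1 h2, fun h => ?_⟩
      have h3 : a * f x + b * f y = 0 := by simpa using h
      refine Submodule.add_mem _ ?_ ?_
      · rcases mul_eq_zero.1 (show a * f x = 0 by linarith) with h | h
        · simp [h]
        · exact Submodule.smul_mem _ _ (hx' h)
      · rcases mul_eq_zero.1 (show b * f y = 0 by linarith) with h | h
        · simp [h]
        · exact Submodule.smul_mem _ _ (hy' h)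
    have hsub : convexHull ℝ (Set.range v) ⊆ C := by
      refine convexHull_min ?_ hC
      rintro _ ⟨i, rfl⟩
      exact ⟨hf i, fun h => Submodule.subset_span ⟨i, h, rfl⟩⟩
    exact (hsub hx).2 hfx
  · refine Submodule.span_mono ?_
    rintro _ ⟨i, hi, rfl⟩
    exact ⟨subset_convexHull ℝ _ ⟨i, rfl⟩, hi⟩

/-- A homogeneous inequality induces a facet of a full-dimensional polytope with vertex `0` iff it
is valid, nontrivial, and the only linear equation on the vertices of its face up to scaling. -/
theorem isFacetInducing_convexHull_iff {E ι : Type*} [AddCommGroup E] [Module ℝ E]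
    [FiniteDimensional ℝ E] {v : ι → E} (i₀ : ι) (h0 : v i₀ = 0)
    (hspan : Submodule.span ℝ (Set.range v) = ⊤) (f : Module.Dual ℝ E) :
    IsFacetInducing (convexHull ℝ (Set.range v)) f 0 ↔
      (∀ i, f (v i) ≤ 0) ∧ f ≠ 0 ∧
        ∀ g : Module.Dual ℝ E, (∀ i, f (v i) = 0 → g (v i) = 0) → ∃ c : ℝ, g = c • f := by
  have hzero : (0 : E) ∈ convexHull ℝ (Set.range v) := subset_convexHull ℝ _ ⟨i₀, h0⟩
  have hP : affDim (convexHull ℝ (Set.range v)) = Module.finrank ℝ E := by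
    rw [affDim, vectorSpan_eq_span_of_zero_mem hzero, ← finrank_top ℝ E, ← hspan]
    rw [le_antisymm (Submodule.span_le.2 (convexHull_min Submodule.subset_span
      (Submodule.convex _))) (Submodule.span_mono (subset_convexHull ℝ (Set.range v)))]
  have hvalid : (∀ x ∈ convexHull ℝ (Set.range v), f x ≤ 0) ↔ ∀ i, f (v i) ≤ 0 := by
    refine ⟨fun h i => h _ (subset_convexHull ℝ _ ⟨i, rfl⟩), fun h x hx => ?_⟩
    have : convexHull ℝ (Set.range v) ⊆ {x | f x ≤ 0} := by
      refine convexHull_min ?_ (convex_halfSpace_le f.isLinear 0)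
      rintro _ ⟨i, rfl⟩
      exact h i
    exact this hx
  have hzero' : (0 : E) ∈ {x ∈ convexHull ℝ (Set.range v) | f x = 0} := ⟨hzero, map_zero f⟩
  rw [IsFacetInducing, hvalid, hP, affDim, vectorSpan_eq_span_of_zero_mem hzero']
  refine and_congr_right fun hv => ?_
  rw [span_face_eq hv, and_iff_right ⟨0, hzero'⟩]
  set R := Submodule.span ℝ (v '' {i | f (v i) = 0}) with hR
  have hann : ∀ g : Module.Dual ℝ E,
      g ∈ R.dualAnnihilator ↔ ∀ i, f (v i) = 0 → g (v i) = 0 := by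
    intro g
    rw [Submodule.mem_dualAnnihilator]
    constructor
    · exact fun h i hi => h _ (Submodule.subset_span ⟨i, hi, rfl⟩)
    · intro h w hw
      have : R ≤ LinearMap.ker g := by
        rw [hR, Submodule.span_le]
        rintro _ ⟨i, hi, rfl⟩
        exact h i hi
      exact this hw
  -- The face contains `0`, so its dimension is that of its span `R`. Codimension one of `R` means
  -- that the equations of `R` form a line.
  have hdim : Module.finrank ℝ R + 1 = Module.finrank ℝ E ↔
      Module.finrank ℝ R.dualAnnihilator = 1 := by
    have := Subspace.finrank_add_finrank_dualAnnihilator_eq R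
    omega
  have hfR : f ∈ R.dualAnnihilator := (hann f).2 fun _ h => h
  rw [hdim]
  constructor
  · intro h
    have hne : f ≠ 0 := by
      rintro rfl
      have : R = ⊤ := by simp [hR, hspan]
      rw [this, Submodule.dualAnnihilator_top] at h
      exact zero_ne_one ((finrank_bot ℝ (Module.Dual ℝ E)).symm.trans h)
    refine ⟨hne, fun g hg => ?_⟩
    have hf0 : (⟨f, hfR⟩ : R.dualAnnihilator) ≠ 0 := fun h => hne (congrArg Subtype.val h)
    obtain ⟨c, hc⟩ := (finrank_eq_one_iff_of_nonzero' (K := ℝ) (V := R.dualAnnihilator) _ hf0).1 h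
      ⟨g, (hann g).2 hg⟩
    exact ⟨c, (congrArg Subtype.val hc).symm⟩
  · rintro ⟨hne, h⟩
    have hf0 : (⟨f, hfR⟩ : R.dualAnnihilator) ≠ 0 := fun h => hne (congrArg Subtype.val h)
    refine (finrank_eq_one_iff_of_nonzero' (K := ℝ) (V := R.dualAnnihilator) _ hf0).2 ?_
    rintro ⟨g, hg⟩
    obtain ⟨c, hc⟩ := h g ((hann g).1 hg)
    exact ⟨c, Subtype.ext hc.symm⟩

theorem affDim_image_linearEquiv {E F : Type*} [AddCommGroup E] [Module ℝ E] [AddCommGroup F]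
    [Module ℝ F] (e : E ≃ₗ[ℝ] F) (P : Set E) : affDim (e '' P) = affDim P := by
  have : vectorSpan ℝ (e '' P) = (vectorSpan ℝ P).map (e : E →ₗ[ℝ] F) :=
    ((e : E →ₗ[ℝ] F).toAffineMap.map_vectorSpan (s := P)).symm
  rw [affDim, this]
  exact LinearEquiv.finrank_map_eq e _

theorem isFacetInducing_image_linearEquiv {E F : Type*} [AddCommGroup E] [Module ℝ E]
    [AddCommGroup F] [Module ℝ F] (e : E ≃ₗ[ℝ] F) (P : Set E) (f : Module.Dual ℝ F) (c : ℝ) :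
    IsFacetInducing (e '' P) f c ↔ IsFacetInducing P (f ∘ₗ e.toLinearMap) c := by
  have h : {x ∈ e '' P | f x = c} = e '' {x ∈ P | (f ∘ₗ e.toLinearMap) x = c} := by
    ext y
    constructor
    · rintro ⟨⟨x, hx, rfl⟩, hy⟩
      exact ⟨x, ⟨hx, hy⟩, rfl⟩
    · rintro ⟨x, ⟨hx, hy⟩, rfl⟩
      exact ⟨⟨x, hx, rfl⟩, hy⟩
  rw [IsFacetInducing, IsFacetInducing, h, affDim_image_linearEquiv, affDim_image_linearEquiv,
    Set.image_nonempty, Set.forall_mem_image]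
  rfl

/-! ### Linear forms on cut vectors -/

/-- The coordinate of the cut vector at the pair `uv`. -/
def sep {V : Type*} (S : V → Bool) (u v : V) : ℝ := if S u = S v then 0 else 1

theorem sep_comm {V : Type*} (S : V → Bool) (u v : V) : sep S u v = sep S v u := by
  simp only [sep, eq_comm]

@[simp] theorem sep_self {V : Type*} (S : V → Bool) (u : V) : sep S u u = 0 := by simp [sep]

/-- The sign of the label of a node. -/
def sgn {V : Type*} (S : V → Bool) (u : V) : ℝ := if S u then -1 else 1

theorem sep_eq {V : Type*} (S : V → Bool) (u v : V) : sep S u v = (1 - sgn S u * sgn S v) / 2 := by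
  unfold sep sgn
  cases S u <;> cases S v <;> norm_num

theorem sgn_ne_zero {V : Type*} (S : V → Bool) (u : V) : sgn S u ≠ 0 := by
  unfold sgn; split_ifs <;> norm_num

variable {V : Type*} {G : SimpleGraph V}

open Classical in
/-- The coefficient of a linear form at the pair `xy`; it is `0` if `xy` is not an edge. -/
def coeff (G : SimpleGraph V) (x y : V) : Module.Dual ℝ (G.edgeSet → ℝ) →ₗ[ℝ] ℝ :=
  if h : G.Adj x y then Module.Dual.eval ℝ _ (Pi.single (edge G x y h) 1) else 0

open Classical in
/-- The coordinate functional at the pair `uv`; it is `0` if `uv` is not an edge. -/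
def pairForm (G : SimpleGraph V) (u v : V) : Module.Dual ℝ (G.edgeSet → ℝ) :=
  if h : G.Adj u v then coord G u v h else 0

theorem coeff_of_not_adj {x y : V} (h : ¬ G.Adj x y) : coeff G x y = 0 := by
  simp [coeff, h]

theorem coeff_comm (x y : V) : coeff G x y = coeff G y x := by
  unfold coeff
  by_cases h : G.Adj x y
  · have : edge G x y h = edge G y x h.symm := Subtype.ext Sym2.eq_swap
    simp [h, h.symm, this]
  · have : ¬ G.Adj y x := fun h' => h h'.symm
    simp [h, this]

theorem cutVector_edge (S : V → Bool) {u v : V} (h : G.Adj u v) :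
    cutVector G S (edge G u v h) = sep S u v := rfl

theorem pairForm_cutVector (S : V → Bool) {u v : V} (h : G.Adj u v) :
    pairForm G u v (cutVector G S) = sep S u v := by
  simp [pairForm, h, coord, cutVector_edge]

theorem coeff_pairForm {u v x y : V} [Decidable (s(x, y) = s(u, v))] (huv : G.Adj u v) :
    coeff G x y (pairForm G u v) = if s(x, y) = s(u, v) then 1 else 0 := by
  by_cases h : G.Adj x y
  · have : edge G u v huv = edge G x y h ↔ s(x, y) = s(u, v) := by
      rw [Subtype.ext_iff]
      exact eq_comm
    simp only [coeff, pairForm, h, huv, coord, dif_pos, Module.Dual.eval_apply,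
      LinearMap.proj_apply, Pi.single_apply]
    exact ite_congr (propext this) (fun _ => rfl) fun _ => rfl
  · have : s(x, y) ≠ s(u, v) := by
      intro h'
      rw [← SimpleGraph.mem_edgeSet, h'] at h
      exact h huv
    rw [if_neg this, coeff_of_not_adj h]
    rfl

/-- The factor 2 comes from summing over ordered pairs; non-edges contribute nothing since `coeff`
is `0` there. -/
theorem two_mul_cutVector [Fintype V] (g : Module.Dual ℝ (G.edgeSet → ℝ)) (S : V → Bool) :
    2 * g (cutVector G S) = ∑ x, ∑ y, coeff G x y g * sep S x y := by
  classical
  have hg : g = ∑ e, g (Pi.single e 1) • LinearMap.proj e := by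
    refine LinearMap.pi_ext' fun e => LinearMap.ext_ring ?_
    simp [Pi.single_apply]
  have key : ∀ e : G.edgeSet, 2 * cutVector G S e =
      ∑ x, ∑ y, coeff G x y (LinearMap.proj e) * sep S x y := by
    rintro ⟨e, he⟩
    induction e using Sym2.ind with
    | _ u v =>
      have huv : G.Adj u v := he
      have h1 : (LinearMap.proj ⟨s(u, v), he⟩ : Module.Dual ℝ (G.edgeSet → ℝ)) =
          pairForm G u v := by simp [pairForm, huv, coord, edge]
      have h2 : cutVector G S ⟨s(u, v), he⟩ = sep S u v := rfl
      have h3 : ∀ x y : V, (if s(x, y) = s(u, v) then (1 : ℝ) else 0) =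
          (if x = u then if y = v then 1 else 0 else 0)
            + (if x = v then if y = u then 1 else 0 else 0) := by
        intro x y
        have := huv.ne
        simp only [Sym2.eq_iff]
        split_ifs <;> simp_all
      rw [h1, h2]
      simp only [coeff_pairForm huv, h3, add_mul, Finset.sum_add_distrib, ite_mul, one_mul,
        zero_mul]
      simp [sep_comm S v u, two_mul]
  have hg' : g (cutVector G S) = ∑ e, g (Pi.single e 1) * cutVector G S e := by
    conv_lhs => rw [hg]
    simp
  rw [hg', Finset.mul_sum]
  conv_rhs => rw [hg]
  simp only [map_sum, map_smul, smul_eq_mul, Finset.sum_mul]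
  calc _ = ∑ e, ∑ x, ∑ y, g (Pi.single e 1) * coeff G x y (LinearMap.proj e) * sep S x y := by
        refine Finset.sum_congr rfl fun e _ => ?_
        rw [mul_left_comm, key e]
        simp only [Finset.mul_sum, mul_assoc]
    _ = _ := by
        rw [Finset.sum_comm]
        exact Finset.sum_congr rfl fun x _ => Finset.sum_comm

/-- The effect on a linear form of moving a node to the other side of the cut. -/
theorem cutVector_flip [Fintype V] [DecidableEq V] (g : Module.Dual ℝ (G.edgeSet → ℝ))
    (S : V → Bool) (v : V) :
    g (cutVector G (Function.update S v (!S v))) - g (cutVector G S) =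
      sgn S v * ∑ w, coeff G v w g * sgn S w := by
  have hloop : ∀ x, coeff G x x g = 0 := fun x => by
    rw [coeff_of_not_adj (G.loopless.irrefl x)]; rfl
  have h2 : ∀ x y, coeff G x y g * (sep (Function.update S v (!S v)) x y - sep S x y) =
      (if x = v then coeff G v y g * (sgn S v * sgn S y) else 0)
        + (if y = v then coeff G v x g * (sgn S v * sgn S x) else 0) := by
    intro x y
    by_cases hx : x = v <;> by_cases hy : y = v
    · subst hx; subst hy; simp [hloop]
    · subst hx
      simp only [if_true, if_neg hy, add_zero, sep_eq]
      congr 1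
      have h1 : sgn (Function.update S x (!S x)) y = sgn S y := by simp [sgn, hy]
      have h2 : sgn (Function.update S x (!S x)) x = - sgn S x := by
        cases h : S x <;> simp [sgn, h]
      rw [h1, h2]; ring
    · subst hy
      simp only [if_true, if_neg hx, zero_add, sep_eq, coeff_comm (G := G) y x]
      congr 1
      have h1 : sgn (Function.update S y (!S y)) x = sgn S x := by simp [sgn, hx]
      have h2 : sgn (Function.update S y (!S y)) y = - sgn S y := by
        cases h : S y <;> simp [sgn, h]
      rw [h1, h2]; ring
    · simp [sep, hx, hy]
  have h3 : 2 * (g (cutVector G (Function.update S v (!S v))) - g (cutVector G S)) =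
      2 * (sgn S v * ∑ w, coeff G v w g * sgn S w) := by
    rw [mul_sub, two_mul_cutVector, two_mul_cutVector, ← Finset.sum_sub_distrib]
    simp only [← Finset.sum_sub_distrib, ← mul_sub, h2, Finset.sum_add_distrib]
    simp only [Finset.sum_ite_eq', Finset.mem_univ, if_true, Finset.sum_ite_irrel,
      Finset.sum_const_zero, ← Finset.sum_add_distrib]
    rw [Finset.mul_sum, Finset.mul_sum]
    exact Finset.sum_congr rfl fun w _ => by ring
  linarith

theorem eq_zero_of_coeff_eq_zero [Finite V] {g : Module.Dual ℝ (G.edgeSet → ℝ)}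
    (h : ∀ x y, G.Adj x y → coeff G x y g = 0) : g = 0 := by
  classical
  refine LinearMap.pi_ext' fun e => LinearMap.ext_ring ?_
  obtain ⟨e, he⟩ := e
  induction e using Sym2.ind with
  | _ u v =>
    have huv : G.Adj u v := he
    have := h u v huv
    simp only [coeff, huv, dif_pos, Module.Dual.eval_apply] at this
    simpa [edge] using this

theorem eq_zero_of_cutVector [Finite V] {g : Module.Dual ℝ (G.edgeSet → ℝ)}
    (h : ∀ S, g (cutVector G S) = 0) : g = 0 := by
  classical
  have := Fintype.ofFinite V
  refine eq_zero_of_coeff_eq_zero fun x y hxy => ?_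
  have hs : ∀ S : V → Bool, ∑ w, coeff G x w g * sgn S w = 0 := by
    intro S
    have := cutVector_flip g S x
    rw [h, h, sub_zero] at this
    exact (mul_eq_zero.1 this.symm).resolve_left (sgn_ne_zero S x)
  -- The two labellings differ only at `y`, so subtracting their sign relations isolates the
  -- coefficient at `xy`.
  have h1 := hs fun _ => false
  have h2 := hs fun w => decide (w = y)
  have h3 : ∑ w, coeff G x w g * (sgn (fun _ => false) w - sgn (fun w => decide (w = y)) w) = 0 := by
    simp only [mul_sub, Finset.sum_sub_distrib]
    rw [h1, h2, sub_zero]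
  rw [Finset.sum_eq_single y] at h3
  · simp [sgn] at h3
    linarith
  · intro w _ hw
    simp [sgn, hw]
  · simp

theorem span_range_cutVector [Finite V] : Submodule.span ℝ (Set.range (cutVector G)) = ⊤ := by
  have := Fintype.ofFinite V
  rw [← Subspace.dualAnnihilator_inj, Submodule.dualAnnihilator_top, eq_bot_iff]
  intro g hg
  rw [Submodule.mem_dualAnnihilator] at hg
  exact eq_zero_of_cutVector fun S => hg _ (Submodule.subset_span ⟨S, rfl⟩)

theorem cutVector_const (b : Bool) : cutVector G (fun _ => b) = 0 := by
  ext ⟨e, he⟩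
  induction e using Sym2.ind with
  | _ u v => simp [cutVector]

theorem isFacetInducing_cutPolytope_iff [Finite V] (f : Module.Dual ℝ (G.edgeSet → ℝ)) :
    IsFacetInducing (cutPolytope G) f 0 ↔
      (∀ S, f (cutVector G S) ≤ 0) ∧ f ≠ 0 ∧
        ∀ g : Module.Dual ℝ (G.edgeSet → ℝ),
          (∀ S, f (cutVector G S) = 0 → g (cutVector G S) = 0) → ∃ c : ℝ, g = c • f :=
  isFacetInducing_convexHull_iff (fun _ => false) (cutVector_const false) span_range_cutVector f

end

section

/-! ### Facets of the cut polytope of a complete graph -/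

section Complete

variable {V : Type*}

theorem pairForm_top_cutVector (S : V → Bool) (u v : V) :
    pairForm (⊤ : SimpleGraph V) u v (cutVector ⊤ S) = sep S u v := by
  by_cases h : u = v
  · subst h
    simp [pairForm]
  · exact pairForm_cutVector S h

/-- A linear form of both signs on the cut vectors does not vanish on all roots of a facet. -/
theorem exists_root_ne_zero {f : Module.Dual ℝ ((⊤ : SimpleGraph V).edgeSet → ℝ)}
    (hv : ∀ S, f (cutVector ⊤ S) ≤ 0)
    (hf : ∀ g, (∀ S, f (cutVector ⊤ S) = 0 → g (cutVector ⊤ S) = 0) → ∃ c : ℝ, g = c • f)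
    {g : Module.Dual ℝ ((⊤ : SimpleGraph V).edgeSet → ℝ)} {S T : V → Bool}
    (hS : 0 < g (cutVector ⊤ S)) (hT : g (cutVector ⊤ T) < 0) :
    ∃ R, f (cutVector ⊤ R) = 0 ∧ g (cutVector ⊤ R) ≠ 0 := by
  by_contra! h
  obtain ⟨c, rfl⟩ := hf g h
  have h1 := hv S
  have h2 := hv T
  simp only [LinearMap.smul_apply, smul_eq_mul] at hS hT
  rcases le_or_gt 0 c with hc | hc
  · nlinarith
  · nlinarith

theorem coeff_triangle {u u' w : V} (huu' : u ≠ u') (hu : w ≠ u) (hu' : w ≠ u') :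
    coeff ⊤ u u' (pairForm (⊤ : SimpleGraph V) u u') = 1 ∧
    coeff ⊤ u u' (pairForm (⊤ : SimpleGraph V) w u) = 0 ∧
    coeff ⊤ u u' (pairForm (⊤ : SimpleGraph V) w u') = 0 := by
  classical
  refine ⟨?_, ?_, ?_⟩
  · rw [coeff_pairForm huu', if_pos rfl]
  · rw [coeff_pairForm hu, if_neg]
    simp [hu.symm, hu'.symm]
  · rw [coeff_pairForm hu', if_neg]
    simp [hu.symm, hu'.symm]

variable [DecidableEq V]

/-- The form `g` in the proof vanishes unless `u`, `u'` agree and `w`, `w'` differ, and it takes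
both signs on cuts. -/
theorem exists_root_eq_ne {f : Module.Dual ℝ ((⊤ : SimpleGraph V).edgeSet → ℝ)}
    (hv : ∀ S, f (cutVector ⊤ S) ≤ 0)
    (hf : ∀ g, (∀ S, f (cutVector ⊤ S) = 0 → g (cutVector ⊤ S) = 0) → ∃ c : ℝ, g = c • f)
    {u u' w w' : V} (huw : u ≠ w) (huw' : u ≠ w') (hu'w : u' ≠ w) (hu'w' : u' ≠ w')
    (hww' : w ≠ w') :
    ∃ S, f (cutVector ⊤ S) = 0 ∧ S u = S u' ∧ S w ≠ S w' := by
  obtain ⟨S, hS, hgS⟩ := exists_root_ne_zero hv hf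
    (g := pairForm ⊤ u w' + pairForm ⊤ u' w' - pairForm ⊤ u w - pairForm ⊤ u' w)
    (S := fun z => decide (z = w')) (T := fun z => decide (z = w))
    (by simp [pairForm_top_cutVector, sep, *]) (by simp [pairForm_top_cutVector, sep, *, hww'.symm])
  refine ⟨S, hS, ?_⟩
  simp only [LinearMap.sub_apply, LinearMap.add_apply, pairForm_top_cutVector, sep] at hgS
  revert hgS
  cases S u <;> cases S u' <;> cases S w <;> cases S w' <;> norm_num

/-- Here the alternating form on the 4-cycle `u w u' w'` is nonzero exactly on cuts separating both
pairs, and it takes both signs. -/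
theorem exists_root_ne_ne {f : Module.Dual ℝ ((⊤ : SimpleGraph V).edgeSet → ℝ)}
    (hv : ∀ S, f (cutVector ⊤ S) ≤ 0)
    (hf : ∀ g, (∀ S, f (cutVector ⊤ S) = 0 → g (cutVector ⊤ S) = 0) → ∃ c : ℝ, g = c • f)
    {u u' w w' : V} (huu' : u ≠ u') (huw : u ≠ w) (huw' : u ≠ w') (hu'w : u' ≠ w)
    (hu'w' : u' ≠ w') (hww' : w ≠ w') :
    ∃ S, f (cutVector ⊤ S) = 0 ∧ S u ≠ S u' ∧ S w ≠ S w' := by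
  obtain ⟨S, hS, hgS⟩ := exists_root_ne_zero hv hf
    (g := pairForm ⊤ u w + pairForm ⊤ u' w' - pairForm ⊤ u w' - pairForm ⊤ u' w)
    (S := fun z => decide (z = u ∨ z = w')) (T := fun z => decide (z = u ∨ z = w))
    (by simp [pairForm_top_cutVector, sep, *, huu'.symm, huw.symm])
    (by simp [pairForm_top_cutVector, sep, *, huu'.symm, huw.symm, huw'.symm, hww'.symm])
  refine ⟨S, hS, ?_⟩
  simp only [LinearMap.sub_apply, LinearMap.add_apply, pairForm_top_cutVector, sep] at hgS
  revert hgS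
  cases S u <;> cases S u' <;> cases S w <;> cases S w' <;> norm_num

theorem sgn_update_of_ne {S : V → Bool} {u v : V} {b : Bool} (h : u ≠ v) :
    sgn (Function.update S v b) u = sgn S u := by simp [sgn, h]

variable [Fintype V]

theorem sum_sgn_flip (h : V → ℝ) (S : V → Bool) (v : V) :
    ∑ w, h w * sgn (Function.update S v (!S v)) w = ∑ w, h w * sgn S w - 2 * (h v * sgn S v) := by
  have : ∀ w, h w * sgn (Function.update S v (!S v)) w =
      h w * sgn S w - (if w = v then 2 * (h v * sgn S v) else 0) := by
    intro w
    by_cases hw : w = v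
    · subst hw
      cases hS : S w <;> simp [sgn, hS] <;> ring
    · simp [sgn, hw]
  simp [this, Finset.sum_sub_distrib]

/-- A linear relation among the signs at the roots of a facet that do not separate `u` and `u'` is
trivial, unless the facet is given by a triangle inequality. -/
theorem sign_relation_same {f : Module.Dual ℝ ((⊤ : SimpleGraph V).edgeSet → ℝ)}
    (hv : ∀ S, f (cutVector ⊤ S) ≤ 0)
    (hf : ∀ g, (∀ S, f (cutVector ⊤ S) = 0 → g (cutVector ⊤ S) = 0) → ∃ c : ℝ, g = c • f)
    {u u' : V} (huu' : u ≠ u') (hp : 0 ≤ coeff ⊤ u u' f) {h : V → ℝ}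
    (hroot : ∀ S, f (cutVector ⊤ S) = 0 → S u = S u' → ∑ w, h w * sgn S w = 0)
    (htri : ∀ w, w ≠ u → w ≠ u' → h w ≠ 0 → ∀ β : ℝ, 0 < β →
      pairForm ⊤ u u' - pairForm ⊤ w u - pairForm ⊤ w u' ≠ β • f) :
    (∀ w, w ≠ u → w ≠ u' → h w = 0) ∧ h u + h u' = 0 := by
  have hsum : ∑ w, h w = 0 := by
    simpa [sgn] using hroot (fun _ => false) (by rw [cutVector_const, map_zero]) rfl
  -- On cuts separating `u` and `u'` the form `L` vanishes identically; on the other roots it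
  -- vanishes by the sign relation. So it is a multiple of `f`.
  set L : Module.Dual ℝ ((⊤ : SimpleGraph V).edgeSet → ℝ) :=
    ∑ w, h w • (pairForm ⊤ w u + pairForm ⊤ w u') with hL
  have hLS : ∀ S, L (cutVector ⊤ S) = - (sgn S u + sgn S u') / 2 * ∑ w, h w * sgn S w := by
    intro S
    simp only [hL, LinearMap.sum_apply, LinearMap.smul_apply, LinearMap.add_apply,
      pairForm_top_cutVector, smul_eq_mul]
    have : ∑ w, h w * (sep S w u + sep S w u') =
        ∑ w, h w + - (sgn S u + sgn S u') / 2 * ∑ w, h w * sgn S w := by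
      rw [Finset.mul_sum, ← Finset.sum_add_distrib]
      exact Finset.sum_congr rfl fun w _ => by rw [sep_eq, sep_eq]; ring
    rw [this, hsum, zero_add]
  obtain ⟨c, hc⟩ := hf L fun S hS => by
    rw [hLS]
    by_cases huS : S u = S u'
    · rw [hroot S hS huS, mul_zero]
    · have : sgn S u + sgn S u' = 0 := by
        revert huS
        unfold sgn
        cases S u <;> cases S u' <;> simp
      simp [this]
  have hflip : ∀ S, f (cutVector ⊤ S) = 0 → S u = S u' → ∀ w, w ≠ u → w ≠ u' →
      c * f (cutVector ⊤ (Function.update S w (!S w))) = 2 * (h w * (sgn S w * sgn S u)) := by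
    intro S hS huS w hu hu'
    have h1 := hLS (Function.update S w (!S w))
    rw [hc, LinearMap.smul_apply, smul_eq_mul, sum_sgn_flip, hroot S hS huS,
      sgn_update_of_ne hu.symm, sgn_update_of_ne hu'.symm] at h1
    have h2 : sgn S u' = sgn S u := by simp [sgn, huS]
    rw [h1, h2]
    ring
  -- By `hflip`, roots with `u`, `u'` together and `w` on their side or on the other side would give
  -- `c * f` opposite signs after flipping `w`. As `f ≤ 0`, only one side occurs; the zero cut shows
  -- that it is the side of `u`. Then the triangle form on `u`, `u'`, `w` vanishes on all roots.
  have hzero : ∀ w, w ≠ u → w ≠ u' → h w = 0 := by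
    intro w hu hu'
    by_contra hw
    have h1 := hflip (fun _ => false) (by rw [cutVector_const, map_zero]) rfl w hu hu'
    simp only [sgn, Bool.false_eq_true, if_false, mul_one] at h1
    have h1' := hv (Function.update (fun _ => false) w (!false))
    obtain ⟨β, hβ⟩ := hf (pairForm ⊤ u u' - pairForm ⊤ w u - pairForm ⊤ w u') fun S hS => by
      simp only [LinearMap.sub_apply, pairForm_top_cutVector]
      by_cases huS : S u = S u'
      · have h2 := hflip S hS huS w hu hu'
        have h2' := hv (Function.update S w (!S w))
        have h3 : S w = S u := by
          by_contra h3
          have : sgn S w * sgn S u = -1 := by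
            revert h3
            unfold sgn
            cases S u <;> cases S w <;> simp
          rw [this] at h2
          have hneg : c * f (cutVector ⊤ (Function.update (fun _ => false) w (!false))) =
              - (c * f (cutVector ⊤ (Function.update S w (!S w)))) := by rw [h1, h2]; ring
          rcases lt_trichotomy c 0 with hc0 | hc0 | hc0
          · have := mul_nonneg_of_nonpos_of_nonpos hc0.le h1'
            have := mul_nonneg_of_nonpos_of_nonpos hc0.le h2'
            exact hw (by linarith)
          · rw [hc0, zero_mul] at h1
            exact hw (by linarith)
          · have := mul_nonpos_of_nonneg_of_nonpos hc0.le h1'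
            have := mul_nonpos_of_nonneg_of_nonpos hc0.le h2'
            exact hw (by linarith)
        simp [sep, huS, h3]
      · unfold sep
        revert huS
        cases S u <;> cases S u' <;> cases S w <;> simp
    have h4 : (1 : ℝ) = β * coeff ⊤ u u' f := by
      obtain ⟨e1, e2, e3⟩ := coeff_triangle huu' hu hu'
      have := congrArg (coeff ⊤ u u') hβ
      rw [map_sub, map_sub, map_smul, e1, e2, e3, smul_eq_mul] at this
      linarith
    refine htri w hu hu' hw β ?_ hβ
    by_contra hβ'
    have := mul_nonpos_of_nonpos_of_nonneg (not_lt.1 hβ') hp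
    linarith
  refine ⟨hzero, ?_⟩
  rw [← hsum, ← Finset.sum_pair huu']
  refine Finset.sum_subset (Finset.subset_univ _) fun w _ hw => ?_
  simp only [Finset.mem_insert, Finset.mem_singleton, not_or] at hw
  exact hzero w hw.1 hw.2

/-- A linear relation among the signs at the roots of a facet that separate `u` and `u'` is
trivial, unless the facet is given by a triangle inequality. -/
theorem sign_relation_opposite {f : Module.Dual ℝ ((⊤ : SimpleGraph V).edgeSet → ℝ)}
    (hv : ∀ S, f (cutVector ⊤ S) ≤ 0)
    (hf : ∀ g, (∀ S, f (cutVector ⊤ S) = 0 → g (cutVector ⊤ S) = 0) → ∃ c : ℝ, g = c • f)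
    {u u' : V} (huu' : u ≠ u') (hp : coeff ⊤ u u' f ≤ 0) {h : V → ℝ}
    (hroot : ∀ S, f (cutVector ⊤ S) = 0 → S u ≠ S u' → ∑ w, h w * sgn S w = 0)
    {N : Set V} (hN : ∀ w, h w ≠ 0 → w ∈ N) {z : V} (hz : z ∈ N) (hzu : z ≠ u) (hzu' : z ≠ u')
    (htri : ∀ w ∈ N, w ≠ u → w ≠ u' → ∀ β : ℝ, 0 < β →
      pairForm ⊤ w u' - pairForm ⊤ w u - pairForm ⊤ u u' ≠ β • f)
    (htri' : ∀ w ∈ N, w ≠ u → w ≠ u' → ∀ β : ℝ, 0 < β →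
      pairForm ⊤ w u - pairForm ⊤ w u' - pairForm ⊤ u u' ≠ β • f) :
    (∀ w, w ≠ u → w ≠ u' → h w = 0) ∧ h u = h u' := by
  -- The difference now replaces the sum, so that `L` vanishes on cuts that do not separate `u` and
  -- `u'`.
  set L : Module.Dual ℝ ((⊤ : SimpleGraph V).edgeSet → ℝ) :=
    ∑ w, h w • (pairForm ⊤ w u' - pairForm ⊤ w u) with hL
  have hLS : ∀ S, L (cutVector ⊤ S) = (sgn S u - sgn S u') / 2 * ∑ w, h w * sgn S w := by
    intro S
    simp only [hL, LinearMap.sum_apply, LinearMap.smul_apply, LinearMap.sub_apply,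
      pairForm_top_cutVector, smul_eq_mul]
    rw [Finset.mul_sum]
    exact Finset.sum_congr rfl fun w _ => by rw [sep_eq, sep_eq]; ring
  obtain ⟨c, hc⟩ := hf L fun S hS => by
    rw [hLS]
    by_cases huS : S u = S u'
    · simp [sgn, huS]
    · rw [hroot S hS huS, mul_zero]
  have hneg : ∀ S : V → Bool, S u ≠ S u' → sgn S u' = - sgn S u := by
    intro S hS
    revert hS
    unfold sgn
    cases S u <;> cases S u' <;> simp
  have hpos : ∀ β : ℝ, β * coeff ⊤ u u' f = -1 → 0 < β := by
    intro β h4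
    by_contra hβ'
    have := mul_nonneg_of_nonpos_of_nonpos (not_lt.1 hβ') hp
    linarith
  have hcoef : ∀ w, w ≠ u → w ≠ u' → ∀ β : ℝ,
      pairForm ⊤ w u' - pairForm ⊤ w u - pairForm ⊤ u u' = β • f ∨
      pairForm ⊤ w u - pairForm ⊤ w u' - pairForm ⊤ u u' = β • f → 0 < β := by
    intro w hu hu' β hβ
    refine hpos β ?_
    obtain ⟨e1, e2, e3⟩ := coeff_triangle huu' hu hu'
    rcases hβ with hβ | hβ <;>
    · have := congrArg (coeff ⊤ u u') hβ
      rw [map_sub, map_sub, map_smul, e1, e2, e3, smul_eq_mul] at this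
      linarith
  have hzero : ∀ w, w ≠ u → w ≠ u' → h w = 0 := by
    intro w hu hu'
    by_contra hw
    -- If `c = 0`, the sign relation holds at all separating cuts, not only at roots, and flipping
    -- `w` contradicts it.
    have hc0 : c ≠ 0 := by
      rintro rfl
      rw [zero_smul] at hc
      have hs : ∀ S : V → Bool, S u ≠ S u' → ∑ w, h w * sgn S w = 0 := by
        intro S hS
        have h1 := hLS S
        rw [hc, LinearMap.zero_apply, hneg S hS] at h1
        have h2 : (sgn S u - - sgn S u) / 2 = sgn S u := by ring
        rw [h2] at h1
        exact (mul_eq_zero.1 h1.symm).resolve_left (sgn_ne_zero S u)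
      have h1 := hs (fun z => decide (z = u)) (by simp [huu'.symm])
      have h2 := hs (Function.update (fun z => decide (z = u)) w (!decide (w = u)))
        (by simp [huu'.symm, hu.symm, hu'.symm])
      rw [sum_sgn_flip h (fun z => decide (z = u)) w, h1] at h2
      have := sgn_ne_zero (fun z => decide (z = u)) w
      have h3 := mul_ne_zero hw this
      exact h3 (by linarith)
    -- Flipping `w` at a separating root cannot make `f` positive, so the sign of `c * h w` decides
    -- on which side `w` lies at all such roots. Each of the two sides forces one triangle equation.
    have hside : ∀ S, f (cutVector ⊤ S) = 0 → S u ≠ S u' → 0 ≤ c * h w * (sgn S w * sgn S u) := by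
      intro S hS huS
      have h1 := hLS (Function.update S w (!S w))
      rw [hc, LinearMap.smul_apply, smul_eq_mul, sum_sgn_flip, hroot S hS huS,
        sgn_update_of_ne hu.symm, sgn_update_of_ne hu'.symm, hneg S huS] at h1
      have h2 := mul_nonpos_of_nonneg_of_nonpos (mul_self_nonneg c)
        (hv (Function.update S w (!S w)))
      rw [mul_assoc, h1] at h2
      linarith
    have hsgn : ∀ S : V → Bool, S w ≠ S u → sgn S w * sgn S u = -1 := by
      intro S hS
      revert hS
      unfold sgn
      cases S u <;> cases S w <;> simp
    have hsgn' : ∀ S : V → Bool, S w = S u → sgn S w * sgn S u = 1 := by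
      intro S hS
      unfold sgn
      rw [hS]
      cases S u <;> simp
    have hwN := hN w hw
    rcases lt_or_gt_of_ne (mul_ne_zero hc0 hw) with hk | hk
    · obtain ⟨β, hβ⟩ := hf (pairForm ⊤ w u - pairForm ⊤ w u' - pairForm ⊤ u u') fun S hS => by
        simp only [LinearMap.sub_apply, pairForm_top_cutVector]
        by_cases huS : S u = S u'
        · simp [sep, huS]
        · have h3 : S w ≠ S u := by
            intro h3
            have := hside S hS huS
            rw [hsgn' S h3] at this
            linarith
          unfold sep
          revert huS h3
          cases S u <;> cases S u' <;> cases S w <;> simp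
      exact htri' w hwN hu hu' β (hcoef w hu hu' β (Or.inr hβ)) hβ
    · obtain ⟨β, hβ⟩ := hf (pairForm ⊤ w u' - pairForm ⊤ w u - pairForm ⊤ u u') fun S hS => by
        simp only [LinearMap.sub_apply, pairForm_top_cutVector]
        by_cases huS : S u = S u'
        · simp [sep, huS]
        · have h3 : S w = S u := by
            by_contra h3
            have := hside S hS huS
            rw [hsgn S h3] at this
            linarith
          unfold sep
          revert huS h3
          cases S u <;> cases S u' <;> cases S w <;> simp
      exact htri w hwN hu hu' β (hcoef w hu hu' β (Or.inl hβ)) hβ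
  refine ⟨hzero, ?_⟩
  by_contra hne
  -- With `h u ≠ h u'` the relation excludes every root separating `u` and `u'`. Then any triangle
  -- form with a third node `z` and negative edge `uu'` vanishes on the roots; this is where `z` is
  -- needed.
  have hall : ∀ S, f (cutVector ⊤ S) = 0 → S u = S u' := by
    intro S hS
    by_contra huS
    have h1 := hroot S hS huS
    have h2 : ∑ w ∈ {u, u'}, h w * sgn S w = ∑ w, h w * sgn S w := by
      refine Finset.sum_subset (Finset.subset_univ _) fun w _ hw => ?_
      simp only [Finset.mem_insert, Finset.mem_singleton, not_or] at hw
      rw [hzero w hw.1 hw.2, zero_mul]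
    rw [h1, Finset.sum_pair huu', hneg S huS] at h2
    have h3 : (h u - h u') * sgn S u = 0 := by linarith
    exact (mul_ne_zero (sub_ne_zero.2 hne) (sgn_ne_zero S u)) h3
  obtain ⟨β, hβ⟩ := hf (pairForm ⊤ z u' - pairForm ⊤ z u - pairForm ⊤ u u') fun S hS => by
    simp [pairForm_top_cutVector, sep, hall S hS]
  exact htri z hz hzu hzu' β (hcoef z hzu hzu' β (Or.inl hβ)) hβ

end Complete

end

section

/-! ### Nodes before and after the elimination -/

/-- The equivalence between the nodes and the disjoint union of the three classes. -/
def nodeEquiv (α β : Type*) : Node α β ≃ Unit ⊕ (α ⊕ β) where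
  toFun
    | .X => .inl ()
    | .A i => .inr (.inl i)
    | .B j => .inr (.inr j)
  invFun
    | .inl _ => .X
    | .inr (.inl i) => .A i
    | .inr (.inr j) => .B j
  left_inv := by rintro (_ | _ | _) <;> rfl
  right_inv := by rintro (_ | _ | _) <;> rfl

theorem sum_node {α β : Type*} [Fintype α] [Fintype β] (f : Node α β → ℝ) :
    ∑ x, f x = f .X + (∑ i, f (.A i) + ∑ j, f (.B j)) := by
  rw [← (nodeEquiv α β).symm.sum_comp, Fintype.sum_sum_type, Fintype.sum_sum_type]
  simp [nodeEquiv]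

theorem sum_pairs {n : ℕ} {F : Fin n → Fin n → ℝ} (hsymm : ∀ i j, F i j = F j i)
    (hdiag : ∀ i, F i i = 0) : ∑ i, ∑ j, F i j = 2 * ∑ p : Pairs n, F p.1.1 p.1.2 := by
  have h1 : ∑ p : Pairs n, F p.1.1 p.1.2 = ∑ i, ∑ j, if i < j then F i j else 0 := by
    rw [← Fintype.sum_prod_type' (f := fun i j => if i < j then F i j else 0),
      ← Finset.sum_filter]
    exact (Finset.sum_subtype _ (by simp) (fun x : Fin n × Fin n => F x.1 x.2)).symm
  have h2 : ∀ i j, (if i < j then F i j else 0) + (if j < i then F j i else 0) = F i j := by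
    intro i j
    rcases lt_trichotomy i j with h | rfl | h
    · simp [h, h.le]
    · simp [hdiag]
    · simp [h, h.le, hsymm i j]
  rw [h1, two_mul]
  conv_rhs =>
    enter [2]
    rw [Finset.sum_comm]
  simp_rw [← Finset.sum_add_distrib, h2]

variable {nA nB : ℕ}

/-- The pairs of nodes of the same party. -/
abbrev SamePair (nA nB : ℕ) : Type := Pairs nA ⊕ Pairs nB

/-- The first node of a pair. -/
def lo : SamePair nA nB → Node (Fin nA) (Fin nB)
  | .inl p => .A p.1.1
  | .inr q => .B q.1.1

/-- The second node of a pair. -/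
def hi : SamePair nA nB → Node (Fin nA) (Fin nB)
  | .inl p => .A p.1.2
  | .inr q => .B q.1.2

/-- A node of the complete graph as a node of the tripartite graph. -/
def old : Node (Fin nA) (Fin nB) → Node (NewA nA nB) (NewB nA nB)
  | .X => .X
  | .A i => .A (.inl i)
  | .B j => .B (.inl j)

/-- The new node of a pair. -/
def new : SamePair nA nB → Node (NewA nA nB) (NewB nA nB)
  | .inl p => .B (.inr p)
  | .inr q => .A (.inr q)

/-- The map that identifies the new node of a pair with the second node of the pair. -/
def back : Node (NewA nA nB) (NewB nA nB) → Node (Fin nA) (Fin nB)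
  | .X => .X
  | .A (.inl i) => .A i
  | .A (.inr q) => .B q.1.2
  | .B (.inl j) => .B j
  | .B (.inr p) => .A p.1.2

@[simp] theorem back_old (v : Node (Fin nA) (Fin nB)) : back (old v) = v := by cases v <;> rfl

@[simp] theorem back_new (p : SamePair nA nB) : back (new p) = hi p := by cases p <;> rfl

theorem lo_ne_hi (p : SamePair nA nB) : lo p ≠ hi p := by
  rcases p with ⟨p, hp⟩ | ⟨p, hp⟩ <;> simp [lo, hi, hp.ne]

@[simp] theorem party_old (v : Node (Fin nA) (Fin nB)) : (old v).party = v.party := by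
  cases v <;> rfl

theorem party_hi (p : SamePair nA nB) : (hi p).party = (lo p).party := by cases p <;> rfl

theorem party_lo_ne (p : SamePair nA nB) : (lo p).party ≠ (new p).party := by
  cases p <;> simp [lo, new, Node.party]

theorem party_X_ne (p : SamePair nA nB) :
    (Node.X : Node (Fin nA) (Fin nB)).party ≠ (new p).party := by
  cases p <;> simp [new, Node.party]

theorem new_injective : Function.Injective (new : SamePair nA nB → _) := by
  rintro (p | p) (q | q) h <;> simp_all [new]

theorem new_ne_old (p : SamePair nA nB) (v : Node (Fin nA) (Fin nB)) : new p ≠ old v := by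
  cases p <;> cases v <;> simp [new, old]

theorem samePair_ext {p q : SamePair nA nB} (h : s(lo p, hi p) = s(lo q, hi q)) : p = q := by
  rcases p with ⟨⟨p₁, p₂⟩, hp⟩ | ⟨⟨p₁, p₂⟩, hp⟩ <;>
    rcases q with ⟨⟨q₁, q₂⟩, hq⟩ | ⟨⟨q₁, q₂⟩, hq⟩ <;>
    simp only [lo, hi, Sym2.eq_iff, Node.A.injEq, Node.B.injEq, reduceCtorEq, and_self,
      or_self] at h <;>
    · have hp' : p₁ < p₂ := hp
      have hq' : q₁ < q₂ := hq
      rcases h with ⟨rfl, rfl⟩ | ⟨rfl, rfl⟩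
      · rfl
      · exact absurd hp' hq'.asymm

theorem exists_samePair {u v : Node (Fin nA) (Fin nB)} (huv : u ≠ v) (h : u.party = v.party) :
    ∃ p : SamePair nA nB, lo p = u ∧ hi p = v ∨ lo p = v ∧ hi p = u := by
  rcases u with _ | i | i <;> rcases v with _ | j | j <;> simp [Node.party] at h huv
  · rcases lt_or_gt_of_ne huv with hij | hij
    · exact ⟨.inl ⟨(i, j), hij⟩, Or.inl ⟨rfl, rfl⟩⟩
    · exact ⟨.inl ⟨(j, i), hij⟩, Or.inr ⟨rfl, rfl⟩⟩
  · rcases lt_or_gt_of_ne huv with hij | hij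
    · exact ⟨.inr ⟨(i, j), hij⟩, Or.inl ⟨rfl, rfl⟩⟩
    · exact ⟨.inr ⟨(j, i), hij⟩, Or.inr ⟨rfl, rfl⟩⟩

theorem sum_new_node (f : Node (NewA nA nB) (NewB nA nB) → ℝ) :
    ∑ x, f x = ∑ v, f (old v) + ∑ p, f (new p) := by
  simp only [sum_node, Fintype.sum_sum_type, old, new]
  ring

/-- The labelling of the nodes after the elimination with the given labels of old and new nodes. -/
def extend (S : Node (Fin nA) (Fin nB) → Bool) (t : SamePair nA nB → Bool) :
    Node (NewA nA nB) (NewB nA nB) → Bool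
  | .X => S .X
  | .A (.inl i) => S (.A i)
  | .A (.inr q) => t (.inr q)
  | .B (.inl j) => S (.B j)
  | .B (.inr p) => t (.inl p)

@[simp] theorem extend_old (S : Node (Fin nA) (Fin nB) → Bool) (t : SamePair nA nB → Bool)
    (v : Node (Fin nA) (Fin nB)) : extend S t (old v) = S v := by cases v <;> rfl

@[simp] theorem extend_new (S : Node (Fin nA) (Fin nB) → Bool) (t : SamePair nA nB → Bool)
    (p : SamePair nA nB) : extend S t (new p) = t p := by cases p <;> rfl

/-! ### The elimination on cut vectors -/

theorem coeff_linForm (a : (completeNodeGraph (Fin nA) (Fin nB)).edgeSet → ℝ)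
    {u v : Node (Fin nA) (Fin nB)} (h : u ≠ v) :
    coeff (completeNodeGraph (Fin nA) (Fin nB)) u v (linForm a) =
      a (edge _ u v (complete_adj h)) := by
  simp [coeff, h, linForm, Module.Dual.eval_apply, Pi.single_apply]

/-- The coefficient of the edge between the nodes of a pair. -/
def pairCoeff (a : (completeNodeGraph (Fin nA) (Fin nB)).edgeSet → ℝ) (p : SamePair nA nB) : ℝ :=
  coeff (completeNodeGraph (Fin nA) (Fin nB)) (lo p) (hi p) (linForm a)

theorem linForm_cutVector (a : (completeNodeGraph (Fin nA) (Fin nB)).edgeSet → ℝ)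
    (S : Node (Fin nA) (Fin nB) → Bool) :
    linForm a (cutVector _ S) =
      ∑ i, a (edge _ .X (.A i) (complete_adj (by simp))) * sep S .X (.A i)
      + ∑ j, a (edge _ .X (.B j) (complete_adj (by simp))) * sep S .X (.B j)
      + ∑ i, ∑ j, a (edge _ (.A i) (.B j) (complete_adj (by simp))) * sep S (.A i) (.B j)
      + ∑ p, pairCoeff a p * sep S (lo p) (hi p) := by
  have h := two_mul_cutVector (linForm a) S
  have hA := sum_pairs (F := fun i j : Fin nA => coeff (completeNodeGraph (Fin nA) (Fin nB))
    (.A i) (.A j) (linForm a) * sep S (.A i) (.A j))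
    (fun i j => by rw [coeff_comm, sep_comm]) (fun i => by simp)
  have hB := sum_pairs (F := fun i j : Fin nB => coeff (completeNodeGraph (Fin nA) (Fin nB))
    (.B i) (.B j) (linForm a) * sep S (.B i) (.B j))
    (fun i j => by rw [coeff_comm, sep_comm]) (fun i => by simp)
  simp only [sum_node, Finset.sum_add_distrib, hA, hB] at h
  have hc : ∀ u v : Node (Fin nA) (Fin nB), coeff (completeNodeGraph (Fin nA) (Fin nB)) u v =
      coeff (completeNodeGraph (Fin nA) (Fin nB)) v u := fun u v => coeff_comm u v
  simp only [sep_self, mul_zero, sep_comm S (.A _) .X, sep_comm S (.B _) .X,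
    sep_comm S (.B _) (.A _), hc (.A _) .X, hc (.B _) .X, hc (.B _) (.A _)] at h
  rw [Finset.sum_comm (f := fun (x : Fin nB) (y : Fin nA) => _)] at h
  rw [Fintype.sum_sum_type]
  simp only [pairCoeff, lo, hi]
  simp only [← coeff_linForm a (u := .X) (v := .A _) (by simp),
    ← coeff_linForm a (u := .X) (v := .B _) (by simp),
    ← coeff_linForm a (u := .A _) (v := .B _) (by simp)]
  linarith

/-- The amount by which the elimination of a pair tightens the inequality at a cut. -/
def slack (a : (completeNodeGraph (Fin nA) (Fin nB)).edgeSet → ℝ)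
    (S : Node (NewA nA nB) (NewB nA nB) → Bool) (p : SamePair nA nB) : ℝ :=
  pairCoeff a p * sep S (old (lo p)) (old (hi p))
    - pairCoeff a p * sep S (old (lo p)) (new p) + |pairCoeff a p| * sep S (old (hi p)) (new p)

theorem elimination_cutVector (a : (completeNodeGraph (Fin nA) (Fin nB)).edgeSet → ℝ)
    (S : Node (NewA nA nB) (NewB nA nB) → Bool) :
    elimination a (cutVector _ S) =
      linForm a (cutVector _ (S ∘ old)) - ∑ p, slack a S p := by
  have hlo : ∀ p : Pairs nA, pairCoeff a (.inl p : SamePair nA nB) =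
      a (edge _ (.A p.1.1) (.A p.1.2) (complete_adj (by simpa using p.2.ne))) :=
    fun p => coeff_linForm a (lo_ne_hi (.inl p))
  have hlo' : ∀ p : Pairs nB, pairCoeff a (.inr p : SamePair nA nB) =
      a (edge _ (.B p.1.1) (.B p.1.2) (complete_adj (by simpa using p.2.ne))) :=
    fun p => coeff_linForm a (lo_ne_hi (.inr p))
  simp only [linForm_cutVector, elimination, LinearMap.add_apply, LinearMap.sum_apply,
    LinearMap.smul_apply, LinearMap.sub_apply, smul_eq_mul, coord, LinearMap.proj_apply,
    cutVector_edge, slack, Fintype.sum_sum_type, hlo, hlo', lo, hi, old, new,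
    Finset.sum_add_distrib, Finset.sum_sub_distrib]
  have h : ∀ u v, sep (S ∘ old) u v = sep S (old u) (old v) := fun _ _ => rfl
  simp only [h, old, sep_comm S (.A (.inr _)) (.B (.inl _))]
  ring

/-- The slack is a nonnegative multiple of a triangle inequality's slack on the two nodes of the
pair and the new node. -/
theorem slack_nonneg (a : (completeNodeGraph (Fin nA) (Fin nB)).edgeSet → ℝ)
    (S : Node (NewA nA nB) (NewB nA nB) → Bool) (p : SamePair nA nB) : 0 ≤ slack a S p := by
  unfold slack sep
  have h1 := neg_abs_le (pairCoeff a p)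
  have h2 := le_abs_self (pairCoeff a p)
  cases S (old (lo p)) <;> cases S (old (hi p)) <;> cases S (new p) <;> simp <;> linarith

/-- The new node of a pair may be on either side of the cut without a loss in the inequality. -/
def IsFree (a : (completeNodeGraph (Fin nA) (Fin nB)).edgeSet → ℝ)
    (S : Node (Fin nA) (Fin nB) → Bool) (p : SamePair nA nB) : Prop :=
  (0 < pairCoeff a p → S (lo p) = S (hi p)) ∧ (pairCoeff a p < 0 → S (lo p) ≠ S (hi p))

theorem slack_eq_zero_of_eq (a : (completeNodeGraph (Fin nA) (Fin nB)).edgeSet → ℝ)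
    {S : Node (NewA nA nB) (NewB nA nB) → Bool} {p : SamePair nA nB}
    (h : S (new p) = S (old (hi p))) : slack a S p = 0 := by
  simp [slack, sep, h]

theorem slack_eq_zero_of_isFree {a : (completeNodeGraph (Fin nA) (Fin nB)).edgeSet → ℝ}
    {S : Node (NewA nA nB) (NewB nA nB) → Bool} {p : SamePair nA nB}
    (h : IsFree a (S ∘ old) p) : slack a S p = 0 := by
  obtain ⟨h1, h2⟩ := h
  simp only [Function.comp] at h1 h2
  rcases lt_trichotomy (pairCoeff a p) 0 with hp | hp | hp
  · have := h2 hp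
    unfold slack sep
    rw [abs_of_neg hp]
    revert this
    cases S (old (lo p)) <;> cases S (old (hi p)) <;> cases S (new p) <;> simp
  · simp [slack, hp]
  · have := h1 hp
    unfold slack sep
    rw [abs_of_pos hp]
    revert this
    cases S (old (lo p)) <;> cases S (old (hi p)) <;> cases S (new p) <;> simp

/-- A new node labelled like the second node of its pair has zero slack, so the original inequality
is recovered by contraction. -/
theorem elimination_back (a : (completeNodeGraph (Fin nA) (Fin nB)).edgeSet → ℝ)
    (S : Node (Fin nA) (Fin nB) → Bool) :
    elimination a (cutVector _ (S ∘ back)) = linForm a (cutVector _ S) := by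
  rw [elimination_cutVector, Finset.sum_eq_zero, sub_zero]
  · congr 2
    funext v
    simp
  · exact fun p _ => slack_eq_zero_of_eq a (by simp)

end

/-! ### Sufficiency: equations of the eliminated face -/

section

variable {nA nB : ℕ}

theorem pairForm_comm {V : Type*} {G : SimpleGraph V} (u v : V) :
    pairForm G u v = pairForm G v u := by
  unfold pairForm
  by_cases h : G.Adj u v
  · have : edge G u v h = edge G v u h.symm := Subtype.ext Sym2.eq_swap
    simp [h, h.symm, coord, this]
  · have : ¬ G.Adj v u := fun h' => h h'.symm
    simp [h, this]

/-- A root of the inequality that remains a root after the elimination. -/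
def IsTightCut (a : (completeNodeGraph (Fin nA) (Fin nB)).edgeSet → ℝ)
    (S : Node (NewA nA nB) (NewB nA nB) → Bool) : Prop :=
  linForm a (cutVector _ (S ∘ old)) = 0 ∧ ∀ p, slack a S p = 0

theorem IsTightCut.elimination_eq_zero {a : (completeNodeGraph (Fin nA) (Fin nB)).edgeSet → ℝ}
    {S : Node (NewA nA nB) (NewB nA nB) → Bool} (h : IsTightCut a S) :
    elimination a (cutVector _ S) = 0 := by
  rw [elimination_cutVector, h.1, Finset.sum_eq_zero fun p _ => h.2 p, sub_zero]

theorem comp_back_comp_old (S : Node (Fin nA) (Fin nB) → Bool) : (S ∘ back) ∘ old = S := by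
  funext v
  simp

theorem isTightCut_back {a : (completeNodeGraph (Fin nA) (Fin nB)).edgeSet → ℝ}
    {S : Node (Fin nA) (Fin nB) → Bool} (h : linForm a (cutVector _ S) = 0) :
    IsTightCut a (S ∘ back) :=
  ⟨by rwa [comp_back_comp_old], fun _ => slack_eq_zero_of_eq a (by simp)⟩

theorem update_new_comp_old (S : Node (NewA nA nB) (NewB nA nB) → Bool) (p : SamePair nA nB)
    (b : Bool) : Function.update S (new p) b ∘ old = S ∘ old := by
  funext v
  simp [(new_ne_old p v).symm]

theorem IsTightCut.update {a : (completeNodeGraph (Fin nA) (Fin nB)).edgeSet → ℝ}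
    {S : Node (NewA nA nB) (NewB nA nB) → Bool} (h : IsTightCut a S) {p : SamePair nA nB}
    (hp : IsFree a (S ∘ old) p) (b : Bool) : IsTightCut a (Function.update S (new p) b) := by
  refine ⟨by rw [update_new_comp_old]; exact h.1, fun r => ?_⟩
  by_cases hr : r = p
  · subst hr
    exact slack_eq_zero_of_isFree (by rwa [update_new_comp_old])
  · rw [← h.2 r]
    simp [slack, sep, (new_ne_old p _).symm, new_injective.ne hr]

/-- Pairs of different parties are disjoint, so the roots on four nodes apply. A zero coefficient
imposes no condition and is treated with the negative ones. -/
theorem exists_root_isFree_isFree {a : (completeNodeGraph (Fin nA) (Fin nB)).edgeSet → ℝ}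
    (hv : ∀ S, linForm a (cutVector _ S) ≤ 0)
    (hf : ∀ g, (∀ S, linForm a (cutVector _ S) = 0 → g (cutVector _ S) = 0) →
      ∃ c : ℝ, g = c • linForm a)
    {p q : SamePair nA nB} (hpq : (lo p).party ≠ (lo q).party) :
    ∃ S, linForm a (cutVector _ S) = 0 ∧ IsFree a S p ∧ IsFree a S q := by
  have h1 : lo p ≠ lo q := fun h => hpq (congrArg Node.party h)
  have h2 : lo p ≠ hi q := fun h => hpq ((congrArg Node.party h).trans (party_hi q))
  have h3 : hi p ≠ lo q := fun h => hpq ((party_hi p).symm.trans (congrArg Node.party h))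
  have h4 : hi p ≠ hi q := fun h =>
    hpq ((party_hi p).symm.trans ((congrArg Node.party h).trans (party_hi q)))
  have hs : ∀ {S : Node (Fin nA) (Fin nB) → Bool} {r : SamePair nA nB}, 0 < pairCoeff a r →
      S (lo r) = S (hi r) → IsFree a S r := fun hr h => ⟨fun _ => h, fun h' => absurd hr h'.asymm⟩
  have ho : ∀ {S : Node (Fin nA) (Fin nB) → Bool} {r : SamePair nA nB}, pairCoeff a r ≤ 0 →
      S (lo r) ≠ S (hi r) → IsFree a S r := fun hr h => ⟨fun h' => absurd h' hr.not_gt, fun _ => h⟩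
  rcases lt_or_ge 0 (pairCoeff a p) with hp | hp <;> rcases lt_or_ge 0 (pairCoeff a q) with hq | hq
  · exact ⟨fun _ => false, by rw [cutVector_const, map_zero], hs hp rfl, hs hq rfl⟩
  · obtain ⟨S, hS, e1, e2⟩ := exists_root_eq_ne hv hf h1 h2 h3 h4 (lo_ne_hi q)
    exact ⟨S, hS, hs hp e1, ho hq e2⟩
  · obtain ⟨S, hS, e1, e2⟩ :=
      exists_root_eq_ne hv hf h1.symm h3.symm h2.symm h4.symm (lo_ne_hi p)
    exact ⟨S, hS, ho hp e2, hs hq e1⟩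
  · obtain ⟨S, hS, e1, e2⟩ := exists_root_ne_ne hv hf (lo_ne_hi p) h1 h2 h3 h4 (lo_ne_hi q)
    exact ⟨S, hS, ho hp e1, ho hq e2⟩

/-- Moving a free new node leads from one root of the elimination to another, so `g` does not
change. -/
theorem sum_coeff_new_eq_zero {a : (completeNodeGraph (Fin nA) (Fin nB)).edgeSet → ℝ}
    {g : Module.Dual ℝ ((tripartite (NewA nA nB) (NewB nA nB)).edgeSet → ℝ)}
    (hg : ∀ S, elimination a (cutVector _ S) = 0 → g (cutVector _ S) = 0)
    {S : Node (NewA nA nB) (NewB nA nB) → Bool} (hS : IsTightCut a S) {p : SamePair nA nB}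
    (hp : IsFree a (S ∘ old) p) : ∑ w, coeff (tripartite _ _) (new p) w g * sgn S w = 0 := by
  have h := cutVector_flip g S (new p)
  rw [hg _ hS.elimination_eq_zero, hg _ (hS.update hp _).elimination_eq_zero, sub_zero] at h
  exact (mul_eq_zero.1 h.symm).resolve_left (sgn_ne_zero S _)

theorem coeff_new_new_eq_zero {a : (completeNodeGraph (Fin nA) (Fin nB)).edgeSet → ℝ}
    (hv : ∀ S, linForm a (cutVector _ S) ≤ 0)
    (hf : ∀ g, (∀ S, linForm a (cutVector _ S) = 0 → g (cutVector _ S) = 0) →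
      ∃ c : ℝ, g = c • linForm a)
    {g : Module.Dual ℝ ((tripartite (NewA nA nB) (NewB nA nB)).edgeSet → ℝ)}
    (hg : ∀ S, elimination a (cutVector _ S) = 0 → g (cutVector _ S) = 0)
    (p q : SamePair nA nB) : coeff (tripartite _ _) (new p) (new q) g = 0 := by
  by_cases hpq : (lo p).party = (lo q).party
  · rw [coeff_of_not_adj]
    · rfl
    · rw [tripartite_adj, not_not]
      rcases p with p | p <;> rcases q with q | q <;> simp_all [lo, new, Node.party]
  -- Compare the relation at `new p` before and after moving `new q`: only the term of `new q`
  -- changes.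
  · obtain ⟨S, hS, hp, hq⟩ := exists_root_isFree_isFree hv hf hpq
    have hT := isTightCut_back hS
    have hp' : IsFree a ((S ∘ back) ∘ old) p := by rwa [comp_back_comp_old]
    have hq' : IsFree a ((S ∘ back) ∘ old) q := by rwa [comp_back_comp_old]
    have h1 := sum_coeff_new_eq_zero hg hT hp'
    have h2 := sum_coeff_new_eq_zero hg (hT.update hq' (!(S ∘ back) (new q)))
      (p := p) (by rwa [update_new_comp_old])
    rw [sum_sgn_flip, h1] at h2
    have h3 := sgn_ne_zero (S ∘ back) (new q)
    exact (mul_eq_zero.1 (by linarith :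
      coeff (tripartite _ _) (new p) (new q) g * sgn (S ∘ back) (new q) = 0)).resolve_right h3

theorem triangle_ne_smul {a : (completeNodeGraph (Fin nA) (Fin nB)).edgeSet → ℝ}
    (ha : ¬ IsOneSidedTriangle a) (p : SamePair nA nB) {x y z : Node (Fin nA) (Fin nB)}
    (hx : x.party ≠ (new p).party) (hy : y.party ≠ (new p).party) (hz : z.party ≠ (new p).party)
    (hxy : x ≠ y) (hxz : x ≠ z) (hyz : y ≠ z) (β : ℝ) (hβ : 0 < β) :
    pairForm (completeNodeGraph (Fin nA) (Fin nB)) x y - pairForm _ x z - pairForm _ y z ≠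
      β • linForm a := by
  intro h
  refine ha ⟨x, y, z, hxy, hxz, hyz, β⁻¹, inv_pos.2 hβ, ?_, ?_⟩
  · rcases p with p | p
    · exact Or.inl ⟨hx, hy, hz⟩
    · exact Or.inr ⟨hx, hy, hz⟩
  · have h' : ∀ {u v : Node (Fin nA) (Fin nB)} (huv : u ≠ v),
        pairForm (completeNodeGraph (Fin nA) (Fin nB)) u v = coord _ u v huv :=
      fun huv => by simp [pairForm, huv]
    rw [← h' hxy, ← h' hxz, ← h' hyz, h, smul_smul, inv_mul_cancel₀ hβ.ne', one_smul]

/-- An equation of the eliminated facet involves each new node only through its own pair. -/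
theorem coeff_new_old {a : (completeNodeGraph (Fin nA) (Fin nB)).edgeSet → ℝ}
    (hv : ∀ S, linForm a (cutVector _ S) ≤ 0)
    (hf : ∀ g, (∀ S, linForm a (cutVector _ S) = 0 → g (cutVector _ S) = 0) →
      ∃ c : ℝ, g = c • linForm a) (ha : ¬ IsOneSidedTriangle a)
    {g : Module.Dual ℝ ((tripartite (NewA nA nB) (NewB nA nB)).edgeSet → ℝ)}
    (hg : ∀ S, elimination a (cutVector _ S) = 0 → g (cutVector _ S) = 0)
    (p : SamePair nA nB) :
    (∀ w, w ≠ lo p → w ≠ hi p → coeff (tripartite _ _) (new p) (old w) g = 0) ∧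
    (coeff (tripartite _ _) (new p) (old (lo p)) g = 0 →
      coeff (tripartite _ _) (new p) (old (hi p)) g = 0) := by
  set h : Node (Fin nA) (Fin nB) → ℝ := fun w => coeff (tripartite _ _) (new p) (old w) g with hh
  have hroot : ∀ S, linForm a (cutVector _ S) = 0 → IsFree a S p → ∑ w, h w * sgn S w = 0 := by
    intro S hS hp
    have := sum_coeff_new_eq_zero hg (isTightCut_back hS) (p := p)
      (by rwa [comp_back_comp_old])
    rw [sum_new_node] at this
    simpa [coeff_new_new_eq_zero hv hf hg, sgn] using this
  -- A new node has no neighbour in its own party, which belongs to the opposite side of its pair.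
  -- So every triangle met below is one-sided.
  have hN : ∀ w, h w ≠ 0 → w.party ≠ (new p).party := by
    intro w hw hwp
    refine hw ?_
    rw [hh]
    simp only
    rw [coeff_of_not_adj]
    · rfl
    · rw [tripartite_adj, not_not, party_old, hwp]
  have hlo := party_lo_ne p
  have hhi : (hi p).party ≠ (new p).party := by rw [party_hi]; exact hlo
  have hXlo : Node.X ≠ lo p := by cases p <;> simp [lo]
  have hXhi : Node.X ≠ hi p := by cases p <;> simp [hi]
  rcases le_or_gt 0 (pairCoeff a p) with hp | hp
  · obtain ⟨h1, h2⟩ := sign_relation_same hv hf (lo_ne_hi p) hp (h := h)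
      (fun S hS he => hroot S hS ⟨fun _ => he, fun h' => absurd h' hp.not_gt⟩)
      (fun w hwl hwh hw β hβ => by
        rw [pairForm_comm w, pairForm_comm w]
        exact triangle_ne_smul ha p hlo hhi (hN w hw) (lo_ne_hi p) hwl.symm hwh.symm β hβ)
    exact ⟨h1, fun h3 => by change h (lo p) = 0 at h3; change h (hi p) = 0; linarith⟩
  · obtain ⟨h1, h2⟩ := sign_relation_opposite hv hf (lo_ne_hi p) hp.le (h := h)
      (fun S hS he => hroot S hS ⟨fun h' => absurd h' hp.asymm, fun _ => he⟩)
      (N := {w | w.party ≠ (new p).party}) hN (z := .X) (party_X_ne p) hXlo hXhi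
      (fun w hw hwl hwh β hβ => by
        rw [pairForm_comm (lo p)]
        exact triangle_ne_smul ha p hw hhi hlo hwh hwl (lo_ne_hi p).symm β hβ)
      (fun w hw hwl hwh β hβ => triangle_ne_smul ha p hw hlo hhi hwl hwh (lo_ne_hi p) β hβ)
    exact ⟨h1, fun h3 => by change h (lo p) = 0 at h3; change h (hi p) = 0; linarith⟩

theorem coeff_sum_pairForm {V : Type*} [Fintype V] {c : V → V → ℝ} (hc : ∀ u v, c u v = c v u)
    (hd : ∀ u, c u u = 0) {x y : V} (hxy : x ≠ y) :
    coeff ⊤ x y (∑ u, ∑ v, c u v • pairForm (⊤ : SimpleGraph V) u v) = 2 * c x y := by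
  classical
  have h : ∀ u v, coeff ⊤ x y (c u v • pairForm (⊤ : SimpleGraph V) u v) =
      (if u = x then if v = y then c x y else 0 else 0)
        + (if u = y then if v = x then c x y else 0 else 0) := by
    intro u v
    rw [map_smul, smul_eq_mul]
    by_cases huv : u = v
    · subst huv
      rw [hd, zero_mul]
      split_ifs <;> simp_all
    · rw [coeff_pairForm huv]
      simp only [Sym2.eq_iff]
      by_cases h1 : u = x ∧ v = y
      · obtain ⟨rfl, rfl⟩ := h1
        simp [hxy]
      · by_cases h2 : u = y ∧ v = x
        · obtain ⟨rfl, rfl⟩ := h2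
          simp [hxy.symm, hc u v]
        · have h3 : ¬ (x = u ∧ y = v ∨ x = v ∧ y = u) := by
            rintro (⟨rfl, rfl⟩ | ⟨rfl, rfl⟩)
            · exact h1 ⟨rfl, rfl⟩
            · exact h2 ⟨rfl, rfl⟩
          rw [if_neg h3, ← ite_and, ← ite_and, if_neg h1, if_neg h2]
          simp
  simp only [map_sum, h, Finset.sum_add_distrib]
  simp [two_mul]

theorem eq_zero_of_back {a : (completeNodeGraph (Fin nA) (Fin nB)).edgeSet → ℝ}
    (hv : ∀ S, linForm a (cutVector _ S) ≤ 0)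
    (hf : ∀ g, (∀ S, linForm a (cutVector _ S) = 0 → g (cutVector _ S) = 0) →
      ∃ c : ℝ, g = c • linForm a) (ha : ¬ IsOneSidedTriangle a)
    {g : Module.Dual ℝ ((tripartite (NewA nA nB) (NewB nA nB)).edgeSet → ℝ)}
    (hg : ∀ S, elimination a (cutVector _ S) = 0 → g (cutVector _ S) = 0)
    (hback : ∀ S : Node (Fin nA) (Fin nB) → Bool, g (cutVector _ (S ∘ back)) = 0) : g = 0 := by
  classical
  have hnn := coeff_new_new_eq_zero hv hf hg
  have hno := coeff_new_old hv hf ha hg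
  -- `R` is twice the contraction of `g` along `back`. An edge from `new p` to `hi p` collapses, and
  -- one from `new p` to `lo p` becomes the edge of the pair, which no old edge of the tripartite
  -- graph covers. Hence the coefficients of `R` determine those of `g`.
  let R : Module.Dual ℝ ((⊤ : SimpleGraph (Node (Fin nA) (Fin nB))).edgeSet → ℝ) :=
    ∑ u, ∑ v, coeff (tripartite _ _) (old u) (old v) g • pairForm ⊤ u v +
      ∑ p, (2 * coeff (tripartite _ _) (new p) (old (lo p)) g) • pairForm ⊤ (lo p) (hi p)
  have hR : R = 0 := by
    refine eq_zero_of_cutVector fun S => ?_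
    have h := two_mul_cutVector g (S ∘ back)
    have hs : ∀ x y, sep (S ∘ back) x y = sep S (back x) (back y) := fun _ _ => rfl
    have h1 : ∀ p, ∑ w, coeff (tripartite _ _) (new p) (old w) g * sep S (hi p) w =
        coeff (tripartite _ _) (new p) (old (lo p)) g * sep S (hi p) (lo p) := by
      intro p
      rw [Finset.sum_eq_single (lo p)]
      · intro w _ hw
        by_cases hw' : w = hi p
        · rw [hw', sep_self, mul_zero]
        · rw [(hno p).1 w hw hw', zero_mul]
      · simp
    rw [hback, mul_zero] at h
    simp only [sum_new_node, hs, back_old, back_new, Finset.sum_add_distrib, hnn, zero_mul,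
      Finset.sum_const_zero, add_zero] at h
    rw [Finset.sum_comm (f := fun v p => coeff (tripartite _ _) (old v) (new p) g * sep S v (hi p))] at h
    simp only [coeff_comm (old _) (new _), sep_comm S _ (hi _), h1] at h
    simp only [R, LinearMap.add_apply, LinearMap.sum_apply, LinearMap.smul_apply, smul_eq_mul,
      pairForm_top_cutVector, sep_comm S (lo _) (hi _), mul_assoc, ← Finset.mul_sum]
    linarith
  have hcoef : ∀ x y, x ≠ y → 2 * coeff (tripartite _ _) (old x) (old y) g +
      ∑ p, 2 * coeff (tripartite _ _) (new p) (old (lo p)) g * (if s(x, y) = s(lo p, hi p) then 1 else 0) = 0 := by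
    intro x y hxy
    have h := congrArg (coeff ⊤ x y) hR
    simp only [R] at h
    rw [map_add, coeff_sum_pairForm (fun u v => by rw [coeff_comm])
      (fun u => by rw [coeff_of_not_adj ((SimpleGraph.loopless _).irrefl _)]; rfl) hxy, map_zero] at h
    refine Eq.trans ?_ h
    rw [map_sum]
    congr 1
    refine Finset.sum_congr rfl fun p _ => ?_
    rw [map_smul, coeff_pairForm (lo_ne_hi p), smul_eq_mul]
  have hnl : ∀ p, coeff (tripartite _ _) (new p) (old (lo p)) g = 0 := by
    intro p
    have h := hcoef (lo p) (hi p) (lo_ne_hi p)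
    have h0 : coeff (tripartite _ _) (old (lo p)) (old (hi p)) g = 0 := by
      rw [coeff_of_not_adj]
      · rfl
      · rw [tripartite_adj, not_not, party_old, party_old, party_hi]
    rw [Finset.sum_eq_single p, if_pos rfl, h0] at h
    · linarith
    · intro q _ hq
      rw [if_neg fun h => hq (samePair_ext h).symm, mul_zero]
    · simp
  have hnew : ∀ p w, coeff (tripartite _ _) (new p) (old w) g = 0 := by
    intro p w
    by_cases h1 : w = lo p
    · rw [h1, hnl]
    · by_cases h2 : w = hi p
      · rw [h2, (hno p).2 (hnl p)]
      · exact (hno p).1 w h1 h2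
  have hold : ∀ v w, v ≠ w → coeff (tripartite _ _) (old v) (old w) g = 0 := by
    intro v w hvw
    have h := hcoef v w hvw
    simp only [hnl, mul_zero, zero_mul, Finset.sum_const_zero] at h
    linarith
  refine eq_zero_of_cutVector fun S => ?_
  have h := two_mul_cutVector g S
  have hold' : ∀ v w, coeff (tripartite _ _) (old v) (old w) g = 0 := by
    intro v w
    by_cases hvw : v = w
    · rw [hvw, coeff_of_not_adj ((SimpleGraph.loopless _).irrefl _)]; rfl
    · exact hold v w hvw
  simp only [sum_new_node, hnn, hold', coeff_comm (old _) (new _), hnew, zero_mul,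
    Finset.sum_const_zero, add_zero] at h
  linarith

theorem elimination_nonpos {a : (completeNodeGraph (Fin nA) (Fin nB)).edgeSet → ℝ}
    (hv : ∀ S, linForm a (cutVector _ S) ≤ 0) (S : Node (NewA nA nB) (NewB nA nB) → Bool) :
    elimination a (cutVector _ S) ≤ 0 := by
  rw [elimination_cutVector]
  have := Finset.sum_nonneg fun p (_ : p ∈ Finset.univ) => slack_nonneg a S p
  have := hv (S ∘ old)
  linarith

theorem isFacetInducing_elimination {a : (completeNodeGraph (Fin nA) (Fin nB)).edgeSet → ℝ}
    (ha : IsFacetInducing (cutPolytope (completeNodeGraph (Fin nA) (Fin nB))) (linForm a) 0)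
    (ht : ¬ IsOneSidedTriangle a) :
    IsFacetInducing (cutPolytope (tripartite (NewA nA nB) (NewB nA nB))) (elimination a) 0 := by
  have : Finite (Node (Fin nA) (Fin nB)) := inferInstance
  have : Finite (Node (NewA nA nB) (NewB nA nB)) := inferInstance
  rw [isFacetInducing_cutPolytope_iff] at ha ⊢
  obtain ⟨hv, hne, hf⟩ := ha
  refine ⟨elimination_nonpos hv, fun h0 => hne ?_, fun g hg => ?_⟩
  · refine eq_zero_of_cutVector fun S => ?_
    rw [← elimination_back, h0, LinearMap.zero_apply]
  -- The sum over ordered pairs makes `r` twice the contraction of `g`, which is why the multiplier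
  -- below is `c / 2`.
  · let r : Module.Dual ℝ ((⊤ : SimpleGraph (Node (Fin nA) (Fin nB))).edgeSet → ℝ) :=
      ∑ x, ∑ y, coeff (tripartite _ _) x y g • pairForm ⊤ (back x) (back y)
    have hr : ∀ S, r (cutVector _ S) = 2 * g (cutVector _ (S ∘ back)) := by
      intro S
      rw [two_mul_cutVector]
      simp only [r, LinearMap.sum_apply, LinearMap.smul_apply, smul_eq_mul,
        pairForm_top_cutVector]
      rfl
    obtain ⟨c, hc⟩ := hf r fun S hS => by
      rw [hr, hg, mul_zero]
      rw [elimination_back, hS]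
    refine ⟨c / 2, sub_eq_zero.1 (eq_zero_of_back hv hf ht (fun S hS => ?_) fun S => ?_)⟩
    · simp [hg S hS, hS]
    · have h := hr S
      rw [hc, LinearMap.smul_apply, smul_eq_mul] at h
      rw [LinearMap.sub_apply, LinearMap.smul_apply, elimination_back, smul_eq_mul]
      linarith

end

section

variable {nA nB : ℕ}

/-! ### The exceptional triangle inequalities -/

theorem isTightCut_of_elimination_eq_zero
    {a : (completeNodeGraph (Fin nA) (Fin nB)).edgeSet → ℝ}
    (hv : ∀ S, linForm a (cutVector _ S) ≤ 0) {S : Node (NewA nA nB) (NewB nA nB) → Bool}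
    (h : elimination a (cutVector _ S) = 0) : IsTightCut a S := by
  rw [elimination_cutVector] at h
  have h1 := Finset.sum_nonneg fun p (_ : p ∈ Finset.univ) => slack_nonneg a S p
  have h2 := hv (S ∘ old)
  refine ⟨by linarith, fun p => ?_⟩
  exact (Finset.sum_eq_zero_iff_of_nonneg fun p _ => slack_nonneg a S p).1 (by linarith) p
    (Finset.mem_univ p)

theorem elimination_le_neg_slack {a : (completeNodeGraph (Fin nA) (Fin nB)).edgeSet → ℝ}
    (hv : ∀ S, linForm a (cutVector _ S) ≤ 0) (S : Node (NewA nA nB) (NewB nA nB) → Bool)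
    (p : SamePair nA nB) : elimination a (cutVector _ S) ≤ - slack a S p := by
  rw [elimination_cutVector]
  have := Finset.single_le_sum (fun p _ => slack_nonneg a S p) (Finset.mem_univ p)
  have := hv (S ∘ old)
  linarith

theorem pairForm_old_new {p : SamePair nA nB} {w : Node (Fin nA) (Fin nB)}
    (hw : w.party ≠ (new p).party) (S : Node (NewA nA nB) (NewB nA nB) → Bool) :
    pairForm (tripartite (NewA nA nB) (NewB nA nB)) (new p) (old w) (cutVector _ S) =
      sep S (new p) (old w) :=
  pairForm_cutVector S (by rw [tripartite_adj, party_old]; exact hw.symm)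

theorem linForm_triangle {a : (completeNodeGraph (Fin nA) (Fin nB)).edgeSet → ℝ} {c : ℝ}
    {u v w : Node (Fin nA) (Fin nB)}
    (ha : linForm a = c • (pairForm (completeNodeGraph (Fin nA) (Fin nB)) u v - pairForm _ u w -
      pairForm _ v w)) (S : Node (Fin nA) (Fin nB) → Bool) :
    linForm a (cutVector _ S) = c * (sep S u v - sep S u w - sep S v w) := by
  simp only [ha, LinearMap.smul_apply, LinearMap.sub_apply, smul_eq_mul,
    pairForm_top_cutVector]

theorem pairCoeff_triangle {a : (completeNodeGraph (Fin nA) (Fin nB)).edgeSet → ℝ} {c : ℝ}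
    {u v w : Node (Fin nA) (Fin nB)} (huv : u ≠ v) (huw : u ≠ w) (hvw : v ≠ w)
    (ha : linForm a = c • (pairForm (completeNodeGraph (Fin nA) (Fin nB)) u v - pairForm _ u w -
      pairForm _ v w)) (p : SamePair nA nB) :
    (s(lo p, hi p) = s(u, v) → pairCoeff a p = c) ∧
    (s(lo p, hi p) = s(v, w) → pairCoeff a p = -c) := by
  classical
  rw [pairCoeff, ha, map_smul, map_sub, map_sub, coeff_pairForm huv, coeff_pairForm huw,
    coeff_pairForm hvw]
  constructor <;> intro h <;> simp [h, huv, huw, hvw, huv.symm, huw.symm, hvw.symm]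

/-- A triangle inequality whose positive edge is eliminated. -/
theorem not_facet_of_positive_pair {a : (completeNodeGraph (Fin nA) (Fin nB)).edgeSet → ℝ}
    (hv : ∀ S, linForm a (cutVector _ S) ≤ 0)
    (hE : ∀ g, (∀ S, elimination a (cutVector _ S) = 0 → g (cutVector _ S) = 0) →
      ∃ c : ℝ, g = c • elimination a) {c : ℝ} (hc : 0 < c) {u v w : Node (Fin nA) (Fin nB)}
    (huv : u ≠ v) (huw : u ≠ w) (hvw : v ≠ w)
    (ha : linForm a = c • (pairForm (completeNodeGraph (Fin nA) (Fin nB)) u v - pairForm _ u w -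
      pairForm _ v w))
    {p : SamePair nA nB} (hu : lo p = u) (hv' : hi p = v) (hw : w.party ≠ (new p).party) :
    False := by
  classical
  have hvp : v.party ≠ (new p).party := by rw [← hv', party_hi]; exact party_lo_ne p
  have hp : pairCoeff a p = c := (pairCoeff_triangle huv huw hvw ha p).1 (by rw [hu, hv'])
  -- `Z` stands for the coordinate `vw`. If `v` and `w` share a party this edge is missing, and at
  -- tight cuts the path through the new node of the pair `vw` (coefficient `-c`) replaces it.
  obtain ⟨Z, hZ, hZ₁, hZ₂⟩ : ∃ Z : Module.Dual ℝ
      ((tripartite (NewA nA nB) (NewB nA nB)).edgeSet → ℝ),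
      (∀ S, IsTightCut a S → Z (cutVector _ S) = sep S (old v) (old w)) ∧
      Z (cutVector _ (extend (fun x => decide (x = u)) (fun q => decide (q = p)))) = 0 ∧
      Z (cutVector _ (extend (fun x => decide (x = w)) (fun q => decide (q = p)))) = 1 := by
    by_cases hvw' : v.party = w.party
    · obtain ⟨q, hq⟩ := exists_samePair hvw hvw'
      have hq' : s(lo q, hi q) = s(v, w) := by
        rcases hq with ⟨h1, h2⟩ | ⟨h1, h2⟩
        · rw [h1, h2]
        · rw [h1, h2, Sym2.eq_swap]
      have hqp : q ≠ p := by
        rintro rfl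
        rw [hu, hv'] at hq'
        simp [huv, huw, hvw] at hq'
      have hqc : pairCoeff a q = -c := (pairCoeff_triangle huv huw hvw ha q).2 hq'
      have hvq : v.party ≠ (new q).party := by
        rcases hq with ⟨h1, h2⟩ | ⟨h1, h2⟩
        · rw [← h1]; exact party_lo_ne q
        · rw [← h2, party_hi]; exact party_lo_ne q
      have hwq : w.party ≠ (new q).party := by rw [← hvw']; exact hvq
      refine ⟨pairForm _ (new q) (old v) + pairForm _ (new q) (old w), fun S hS => ?_, ?_, ?_⟩
      · have h := hS.2 q
        rw [LinearMap.add_apply, pairForm_old_new hvq, pairForm_old_new hwq]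
        rw [slack, hqc, abs_neg, abs_of_pos hc] at h
        have h' : c * (sep S (new q) (old v) + sep S (new q) (old w) - sep S (old v) (old w)) =
            0 := by
          rcases hq with ⟨h1, h2⟩ | ⟨h1, h2⟩
          · rw [h1, h2, sep_comm S _ (new q), sep_comm S _ (new q)] at h
            linarith
          · rw [h1, h2, sep_comm S _ (new q), sep_comm S _ (new q),
              sep_comm S (old w) (old v)] at h
            linarith
        have := (mul_eq_zero.1 h').resolve_left hc.ne'
        linarith
      · rw [LinearMap.add_apply, pairForm_old_new hvq, pairForm_old_new hwq]
        simp [sep, hqp, huv.symm, huw.symm]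
      · rw [LinearMap.add_apply, pairForm_old_new hvq, pairForm_old_new hwq]
        simp [sep, hqp, hvw]
    · have hadj : (tripartite (NewA nA nB) (NewB nA nB)).Adj (old v) (old w) := by
        rw [tripartite_adj, party_old, party_old]
        exact hvw'
      refine ⟨pairForm _ (old v) (old w), fun S _ => pairForm_cutVector S hadj, ?_, ?_⟩
      · rw [pairForm_cutVector _ hadj]
        simp [sep, huv.symm, huw.symm]
      · rw [pairForm_cutVector _ hadj]
        simp [sep, hvw]
  -- An extra equation at tight cuts: if `u` and `v` are separated, `new p` sits with `v`; otherwise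
  -- `u`, `v`, `w` are together.
  obtain ⟨k, hk⟩ := hE (pairForm _ (new p) (old w) - pairForm _ (new p) (old v) - Z) fun S hS => by
    have hS' := isTightCut_of_elimination_eq_zero hv hS
    rw [LinearMap.sub_apply, LinearMap.sub_apply, pairForm_old_new hw, pairForm_old_new hvp,
      hZ S hS']
    have h1 := hS'.1
    have h2 := hS'.2 p
    rw [linForm_triangle ha] at h1
    have h1' := (mul_eq_zero.1 h1).resolve_left hc.ne'
    rw [slack, hp, abs_of_pos hc, hu, hv'] at h2
    have h2' := (mul_eq_zero.1 (show c * (sep S (old u) (old v) - sep S (old u) (new p)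
      + sep S (old v) (new p)) = 0 by linarith)).resolve_left hc.ne'
    have hs : ∀ x y, sep (S ∘ old) x y = sep S (old x) (old y) := fun _ _ => rfl
    rw [hs, hs, hs] at h1'
    simp only [sep] at h1' h2' ⊢
    revert h1' h2'
    cases S (old u) <;> cases S (old v) <;> cases S (old w) <;> cases S (new p) <;> norm_num
  -- At the cut `{u, new p}` the extra form is `0` but the elimination is at most `-2 * c`, so `k =
  -- 0`. At `{w, new p}` the extra form is `-2`, a contradiction.
  have h1 := congrArg (fun g : Module.Dual ℝ _ => g (cutVector _
    (extend (fun x => decide (x = u)) (fun q => decide (q = p))))) hk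
  have h2 := congrArg (fun g : Module.Dual ℝ _ => g (cutVector _
    (extend (fun x => decide (x = w)) (fun q => decide (q = p))))) hk
  simp only [LinearMap.sub_apply, pairForm_old_new hw, pairForm_old_new hvp, hZ₁, hZ₂,
    LinearMap.smul_apply, smul_eq_mul] at h1 h2
  have h3 := elimination_le_neg_slack hv
    (extend (fun x => decide (x = u)) (fun q => decide (q = p))) p
  simp only [slack, hp, abs_of_pos hc, hu, hv'] at h3
  simp [sep, huv.symm, huw.symm] at h1
  simp [sep, huv.symm] at h3
  rcases h1 with h1 | h1
  · simp [sep, h1, hvw] at h2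
    norm_num at h2
  · linarith

/-- A triangle inequality with the node `X` on its positive edge. -/
theorem not_facet_of_positive_X {a : (completeNodeGraph (Fin nA) (Fin nB)).edgeSet → ℝ}
    (hv : ∀ S, linForm a (cutVector _ S) ≤ 0)
    (hE : ∀ g, (∀ S, elimination a (cutVector _ S) = 0 → g (cutVector _ S) = 0) →
      ∃ c : ℝ, g = c • elimination a) {c : ℝ} (hc : 0 < c) {v w : Node (Fin nA) (Fin nB)}
    (hXv : .X ≠ v) (hXw : .X ≠ w) (hvw : v ≠ w)
    (ha : linForm a = c • (pairForm (completeNodeGraph (Fin nA) (Fin nB)) .X v -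
      pairForm _ .X w - pairForm _ v w)) (hparty : v.party = w.party) : False := by
  classical
  obtain ⟨p, hp⟩ := exists_samePair hvw hparty
  have hp' : s(lo p, hi p) = s(v, w) := by
    rcases hp with ⟨h1, h2⟩ | ⟨h1, h2⟩
    · rw [h1, h2]
    · rw [h1, h2, Sym2.eq_swap]
  have hpc : pairCoeff a p = -c := (pairCoeff_triangle hXv hXw hvw ha p).2 hp'
  have hwp : w.party ≠ (new p).party := by
    rcases hp with ⟨h1, h2⟩ | ⟨h1, h2⟩
    · rw [← h2, party_hi]; exact party_lo_ne p
    · rw [← h1]; exact party_lo_ne p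
  have hXp := party_X_ne p
  have hslack : ∀ S, slack a S p =
      c * (sep S (new p) (old v) + sep S (new p) (old w) - sep S (old v) (old w)) := by
    intro S
    rw [slack, hpc, abs_neg, abs_of_pos hc, sep_comm S _ (new p), sep_comm S _ (new p)]
    rcases hp with ⟨h1, h2⟩ | ⟨h1, h2⟩
    · rw [h1, h2]; ring
    · rw [h1, h2, sep_comm S (old w) (old v)]; ring
  have hadj : (tripartite (NewA nA nB) (NewB nA nB)).Adj (old .X) (old w) := by
    rw [tripartite_adj, party_old, party_old]
    rcases w with _ | _ | _
    · exact absurd rfl hXw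
    · simp [Node.party]
    · simp [Node.party]
  -- At tight cuts, if `v` and `w` are together then `new p` joins them; otherwise `w` is with `X`.
  -- Both cases give the extra equation.
  obtain ⟨k, hk⟩ := hE (pairForm _ (new p) (old .X) - pairForm _ (new p) (old w) -
      pairForm _ (old .X) (old w)) fun S hS => by
    have hS' := isTightCut_of_elimination_eq_zero hv hS
    rw [LinearMap.sub_apply, LinearMap.sub_apply, pairForm_old_new hXp, pairForm_old_new hwp,
      pairForm_cutVector S hadj]
    have h1 := hS'.1
    have h2 := hS'.2 p
    rw [linForm_triangle ha] at h1
    have h1' := (mul_eq_zero.1 h1).resolve_left hc.ne'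
    rw [hslack] at h2
    have h2' := (mul_eq_zero.1 h2).resolve_left hc.ne'
    have hs : ∀ x y, sep (S ∘ old) x y = sep S (old x) (old y) := fun _ _ => rfl
    rw [hs, hs, hs] at h1'
    simp only [sep] at h1' h2' ⊢
    revert h1' h2'
    cases S (old .X) <;> cases S (old v) <;> cases S (old w) <;> cases S (new p) <;> norm_num
  -- The cut `{new p}` forces `k = 0`, and at `{w}` the extra form is `-2`.
  have h1 := congrArg (fun g : Module.Dual ℝ _ => g (cutVector _
    (extend (fun _ => false) (fun q => decide (q = p))))) hk
  have h2 := congrArg (fun g : Module.Dual ℝ _ => g (cutVector _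
    (extend (fun x => decide (x = w)) (fun _ => false)))) hk
  simp only [LinearMap.sub_apply, pairForm_old_new hXp, pairForm_old_new hwp,
    pairForm_cutVector _ hadj, LinearMap.smul_apply, smul_eq_mul] at h1 h2
  have h3 := elimination_le_neg_slack hv (extend (fun _ => false) (fun q => decide (q = p))) p
  rw [hslack] at h3
  simp [sep] at h1
  simp [sep] at h3
  rcases h1 with h1 | h1
  · simp [sep, h1, hXw] at h2
    norm_num at h2
  · linarith

theorem not_isFacetInducing_elimination
    {a : (completeNodeGraph (Fin nA) (Fin nB)).edgeSet → ℝ}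
    (ha : IsFacetInducing (cutPolytope (completeNodeGraph (Fin nA) (Fin nB))) (linForm a) 0)
    (ht : IsOneSidedTriangle a) :
    ¬ IsFacetInducing (cutPolytope (tripartite (NewA nA nB) (NewB nA nB))) (elimination a) 0 := by
  have : Finite (Node (Fin nA) (Fin nB)) := inferInstance
  have : Finite (Node (NewA nA nB) (NewB nA nB)) := inferInstance
  rw [isFacetInducing_cutPolytope_iff] at ha ⊢
  rintro ⟨-, -, hE⟩
  have hv := ha.1
  obtain ⟨u, v, w, huv, huw, hvw, c, hc, hside, h⟩ := ht
  have hcoord : ∀ {u v : Node (Fin nA) (Fin nB)} (huv : u ≠ v),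
      coord _ u v huv = pairForm (completeNodeGraph (Fin nA) (Fin nB)) u v :=
    fun huv => by simp [pairForm, huv]
  rw [hcoord huv, hcoord huw, hcoord hvw] at h
  have h' : linForm a = c • (pairForm (completeNodeGraph (Fin nA) (Fin nB)) v u -
      pairForm _ v w - pairForm _ u w) := by
    rw [h, pairForm_comm u v, sub_right_comm]
  have hw : ∀ p : SamePair nA nB, lo p = u ∨ lo p = v → w.party ≠ (new p).party := by
    intro p hp
    rcases p with p | p
    · rcases hside with hs | hs
      · exact hs.2.2
      · rcases hp with rfl | rfl
        · exact absurd rfl hs.1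
        · exact absurd rfl hs.2.1
    · rcases hside with hs | hs
      · rcases hp with rfl | rfl
        · exact absurd rfl hs.1
        · exact absurd rfl hs.2.1
      · exact hs.2.2
  by_cases hparty : u.party = v.party
  · obtain ⟨p, ⟨h1, h2⟩ | ⟨h1, h2⟩⟩ := exists_samePair huv hparty
    · exact not_facet_of_positive_pair hv hE hc huv huw hvw h h1 h2 (hw p (Or.inl h1))
    · exact not_facet_of_positive_pair hv hE hc huv.symm hvw huw h' h1 h2 (hw p (Or.inr h1))
  -- If the ends of the positive edge have different parties, one of them is `X`, and the other
  -- shares its party with `w`.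
  · have hX : ∀ x y : Node (Fin nA) (Fin nB), .X ≠ x → .X ≠ y →
        (x.party ≠ 2 ∧ y.party ≠ 2 ∨ x.party ≠ 1 ∧ y.party ≠ 1) → x.party = y.party := by
      rintro (_ | x | x) (_ | y | y) <;> simp [Node.party]
    by_cases hu : Node.X = u
    · subst hu
      exact not_facet_of_positive_X hv hE hc huv huw hvw h
        (hX v w huv huw (hside.imp And.right And.right))
    · by_cases hv' : Node.X = v
      · subst hv'
        exact not_facet_of_positive_X hv hE hc hu hvw huw h'
          (hX u w hu hvw (hside.imp (fun h => ⟨h.1, h.2.2⟩) (fun h => ⟨h.1, h.2.2⟩)))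
      · exact hparty (hX u v hu hv' (hside.imp (fun h => ⟨h.1, h.2.1⟩) (fun h => ⟨h.1, h.2.1⟩)))

/-! ### Bell inequalities -/

theorem image_bellIso_correlationPolytope (α β : Type*) :
    bellIso α β '' correlationPolytope α β = cutPolytope (tripartite α β) := by
  -- An outcome is the label relative to `X`, and `s + t - 2 * s * t` is the exclusive or of two
  -- bits.
  have key : ∀ (s : α → Bool) (t : β → Bool) (S : Node α β → Bool),
      (∀ i, s i = (S .X ^^ S (.A i))) → (∀ j, t j = (S .X ^^ S (.B j))) →
      bellIso α β (configVector s t) = cutVector _ S := by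
    intro s t S hs ht
    funext e
    obtain ⟨r, rfl⟩ := (resultEdgeEquiv α β).surjective e
    have h : bellIso α β (configVector s t) (resultEdgeEquiv α β r) =
        toCutCoord (configVector s t) r := by
      simp [bellIso]
    rw [h]
    rcases r with i | j | ⟨i, j⟩
    · change _ = sep S .X (.A i)
      simp only [toCutCoord, configVector, sep, hs]
      cases S .X <;> cases S (.A i) <;> simp
    · change _ = sep S .X (.B j)
      simp only [toCutCoord, configVector, sep, ht]
      cases S .X <;> cases S (.B j) <;> simp
    · change _ = sep S (.A i) (.B j)
      simp only [toCutCoord, configVector, sep, hs, ht]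
      cases S .X <;> cases S (.A i) <;> cases S (.B j) <;> norm_num
  have himage : bellIso α β '' {q | ∃ s t, q = configVector s t} =
      Set.range (cutVector (tripartite α β)) := by
    ext x
    constructor
    · rintro ⟨_, ⟨s, t, rfl⟩, rfl⟩
      let S : Node α β → Bool
        | .X => false
        | .A i => s i
        | .B j => t j
      exact ⟨S, (key s t S (fun i => by simp [S]) (fun j => by simp [S])).symm⟩
    · rintro ⟨S, rfl⟩
      exact ⟨_, ⟨fun i => S .X ^^ S (.A i), fun j => S .X ^^ S (.B j), rfl⟩,
        key _ _ S (fun _ => rfl) (fun _ => rfl)⟩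
  rw [correlationPolytope, cutPolytope, ← himage]
  exact (bellIso α β).toLinearMap.image_convexHull _

theorem isFacetInducing_iff_isTightBell {α β : Type*}
    (f : Module.Dual ℝ ((tripartite α β).edgeSet → ℝ)) (c : ℝ) :
    IsFacetInducing (cutPolytope (tripartite α β)) f c ↔
      IsTightBell (f ∘ₗ (bellIso α β).toLinearMap) c := by
  rw [← image_bellIso_correlationPolytope, isFacetInducing_image_linearEquiv, IsTightBell]

-- Pairs are counted by their larger index `j`, which leaves `j` choices for the smaller one.
theorem card_pairs (n : ℕ) : Fintype.card (Pairs n) = n.choose 2 := by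
  have h : Fintype.card (Pairs n) = ∑ j : Fin n, (j : ℕ) := by
    rw [Fintype.card_subtype, Finset.card_filter, Fintype.sum_prod_type, Finset.sum_comm]
    refine Finset.sum_congr rfl fun j _ => ?_
    rw [← Finset.card_filter]
    have : (Finset.univ.filter fun i : Fin n => i < j) = Finset.Iio j := by ext; simp
    simp only [this, Fin.card_Iio]
  rw [h, Fin.sum_univ_eq_sum_range (fun i => i) n, Finset.sum_range_id, Nat.choose_two_right]

end

end TriangularElimination

end

theorem theorem2p1 (nA nB : ℕ)
    (a : (completeNodeGraph (Fin nA) (Fin nB)).edgeSet → ℝ)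
    (ha : IsFacetInducing (cutPolytope (completeNodeGraph (Fin nA) (Fin nB))) (linForm a) 0) :
    -- the numbers of observables after the elimination
    Fintype.card (NewA nA nB) = nA + nB.choose 2 ∧
    Fintype.card (NewB nA nB) = nB + nA.choose 2 ∧
    -- the elimination is facet inducing, with exactly the listed exceptions
    (IsFacetInducing (cutPolytope (tripartite (NewA nA nB) (NewB nA nB))) (elimination a) 0 ↔
      ¬ IsOneSidedTriangle a) ∧
    -- the isomorphism carries the correlation polytope onto the cut polytope
    bellIso (NewA nA nB) (NewB nA nB) '' correlationPolytope (NewA nA nB) (NewB nA nB) =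
      cutPolytope (tripartite (NewA nA nB) (NewB nA nB)) ∧
    -- and identifies the facet inequalities with the tight Bell inequalities
    (∀ (f : Module.Dual ℝ ((tripartite (NewA nA nB) (NewB nA nB)).edgeSet → ℝ)) (c : ℝ),
      IsFacetInducing (cutPolytope (tripartite (NewA nA nB) (NewB nA nB))) f c ↔
        IsTightBell (f ∘ₗ (bellIso (NewA nA nB) (NewB nA nB)).toLinearMap) c) ∧
    -- in particular the Bell inequality of the elimination is tight, with the same exceptions
    (IsTightBell (elimination a ∘ₗ (bellIso (NewA nA nB) (NewB nA nB)).toLinearMap) 0 ↔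
      ¬ IsOneSidedTriangle a) := by
  have hfacet : IsFacetInducing (cutPolytope (tripartite (NewA nA nB) (NewB nA nB)))
      (elimination a) 0 ↔ ¬ IsOneSidedTriangle a :=
    ⟨fun h ht => not_isFacetInducing_elimination ha ht h, isFacetInducing_elimination ha⟩
  refine ⟨?_, ?_, hfacet, image_bellIso_correlationPolytope _ _,
    fun f c => isFacetInducing_iff_isTightBell f c, ?_⟩
  · rw [Fintype.card_sum, card_pairs, Fintype.card_fin]
  · rw [Fintype.card_sum, card_pairs, Fintype.card_fin]
  · rw [← isFacetInducing_iff_isTightBell]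
    exact hfacet
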